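/- Let $A(z)=\sum_j \alpha_j/(z-\delta_j)$ be a proper rational $2\times 2$ matrix function with simple poles that is real on the real axis: its finitely many poles are $\delta_1=0$, further real poles $\delta_k$, and nonreal poles occurring in complex conjugate pairs with complex conjugate residues. (In the application $A=A_n$ is the coefficient matrix of the differential equation satisfied by the $n$th orthogonal polynomials of an equilibrium measure, and there are $4N-2$ poles.) Suppose that $1<d$ and that no pole other than $\delta_1$ lies in $[0,d)$; for instance $d=\delta_2$. Put $\beta_j=\alpha_j-\tfrac12\operatorname{trace}(\alpha_j)I$, $B(x)=\sum_j\beta_j/(x-\delta_j)$ and $J=\begin{pmatrix}0&-1\\1&0\end{pmatrix}$. Suppose that $\beta_1$ has real eigenvalues $\pm\kappa$ with $2\kappa\notin\mathbb Z$. For a real pole $\delta_k\neq\delta_1$ the matrix $(\delta_1-\delta_k)J\beta_k$ is real symmetric; it is congruent over $\mathbb R$ to a matrix $\sigma_k$ in the list $$\pm\begin{pmatrix}1&0\\0&1\end{pmatrix},\quad \pm\begin{pmatrix}1&0\\0&0\end{pmatrix},\quad \begin{pmatrix}1&0\\0&-1\end{pmatrix},\quad \begin{pmatrix}0&0\\0&0\end{pmatrix}.\qquad(*)$$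 For a pair of nonreal poles $\delta_k,\delta_{k'}=\overline{\delta_k}$, let $M=(\delta_1-\delta_k)J\beta_k$; there are $\sigma_k,\sigma_{k'}$ in the list $(*)$ such that the block diagonal sum of $\sigma_k$ and $\sigma_{k'}$ is congruent over $\mathbb R$ to the $4\times 4$ matrix of the real quadratic form $w\mapsto w^{T}Mw+\overline{w^{T}Mw}$ on $\mathbb C^2\cong\mathbb R^4$. Let $\sigma$ be the block diagonal sum of such $\sigma_k$ over all poles other than $\delta_1$, a constant real matrix of size $m=2(\text{number of poles}-1)$ (so $m=8N-6$ in the application). (i) There is a nonzero real $2\times1$ vector solution $Z$ of $dZ/dx=B(x)Z$ on $(0,d)$ such that $Z(x)\to0$ as $x\to\delta_1=0$. (ii) For every real vector solution $Z$ of $dZ/dx=B(x)Z$ on $(0,d)$ with $Z(x)\to 0$ as $x\to 0$, the integral operator $K$ on $L^2((0,1),dx/x)$ with kernel $$K(z,\zeta)=\frac{\sqrt{z\zeta}\,Z(\zeta)^{\dagger}JZ(z)}{z-\zeta}$$ is bounded and of trace class; moreover, for every $\sigma$ as above there is a continuous $\psi:(0,1)\to\mathbb R^{m}$ such that the vector Hankel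 operator $\Gamma_\psi f(x)=\int_0^1\psi(xy)f(y)\,\frac{dy}{y}$ is bounded from $L^2((0,1),dy/y;\mathbb R)$ to $L^2((0,1),dy/y;\mathbb R^m)$ and $$K=\Gamma_\psi^{\dagger}\,\sigma\,\Gamma_\psi .$$ (iii) If $\sigma\ge0$, then $K\ge0$. -/

import Mathlib

open MeasureTheory Set Filter Topology

noncomputable section

namespace SchlesingerKernel

/-- The symplectic matrix `J`. -/
def J : Matrix (Fin 2) (Fin 2) ℝ := !![0, -1; 1, 0]

/-- The data of a proper rational `2 × 2` matrix function that is real on the real axis and has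
simple poles:
`A(z) = α₁ / z + ∑ₖ αₖ / (z - aₖ) + ∑ₗ (ηₗ / (z - cₗ) + conj ηₗ / (z - conj cₗ))`.
The pole `δ₁` is normalised to be `0`; the remaining poles are the real `aₖ` (`k < p`) and the
conjugate pairs `cₗ, conj cₗ` (`l < q`). Poles may be repeated. -/
structure Residues (p q : ℕ) where
  /-- residue at `δ₁ = 0` -/
  α₁ : Matrix (Fin 2) (Fin 2) ℝ
  /-- the other real poles -/
  a : Fin p → ℝ
  /-- residues at the other real poles -/
  α : Fin p → Matrix (Fin 2) (Fin 2) ℝ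
  /-- one pole out of each conjugate pair -/
  c : Fin q → ℂ
  /-- the residue at that pole -/
  η : Fin q → Matrix (Fin 2) (Fin 2) ℂ

/-- `α + ν I` with `ν = - trace α / 2`. -/
def traceless {R : Type} [Field R] (α : Matrix (Fin 2) (Fin 2) R) : Matrix (Fin 2) (Fin 2) R :=
  α + (-(α.trace / 2)) • (1 : Matrix (Fin 2) (Fin 2) R)

variable {p q : ℕ}

/-- The matrix `β₁`. -/
def Residues.β₁ (S : Residues p q) : Matrix (Fin 2) (Fin 2) ℝ := traceless S.α₁

/-- The matrices `βₖ` at the other real poles. -/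
def Residues.β (S : Residues p q) (k : Fin p) : Matrix (Fin 2) (Fin 2) ℝ := traceless (S.α k)

/-- The matrices `β` at the poles `cₗ`; at `conj cₗ` one has the complex conjugate matrix. -/
def Residues.γ (S : Residues p q) (l : Fin q) : Matrix (Fin 2) (Fin 2) ℂ := traceless (S.η l)

/-- The coefficient matrix `B(x) = ∑ⱼ βⱼ / (x - δⱼ)` at a real point `x`. The two summands that
belong to a conjugate pair of poles are complex conjugates, so they add up to twice the real part
of one of them. -/
def Residues.B (S : Residues p q) (x : ℝ) : Matrix (Fin 2) (Fin 2) ℝ :=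
  x⁻¹ • S.β₁ + ∑ k, (x - S.a k)⁻¹ • S.β k
    + ∑ l, (2 : ℝ) • (((x : ℂ) - S.c l)⁻¹ • S.γ l).map Complex.re

/-- `Z` is a real vector solution of `dZ/dx = B(x) Z` on `(0, d)` with `Z(x) → 0` as `x → 0+`. -/
def Residues.IsVanishingSolution (S : Residues p q) (d : ℝ) (Z : ℝ → Fin 2 → ℝ) : Prop :=
  (∀ x ∈ Ioo 0 d, HasDerivAt Z (Matrix.mulVec (S.B x) (Z x)) x) ∧
    Tendsto Z (𝓝[>] 0) (𝓝 0)

/-! ### The signature matrix -/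

/-- Real congruence of square matrices. -/
def Congruent {n : Type} [Fintype n] [DecidableEq n] (A B : Matrix n n ℝ) : Prop :=
  ∃ P : Matrix n n ℝ, IsUnit P.det ∧ P.transpose * A * P = B

/-- The admissible `2 × 2` signature blocks. -/
def signatureBlocks : Set (Matrix (Fin 2) (Fin 2) ℝ) :=
  {!![1, 0; 0, 1], -!![1, 0; 0, 1], !![1, 0; 0, 0], -!![1, 0; 0, 0], !![1, 0; 0, -1], 0}

/-- The real symmetric matrix `(δ₁ - δₖ) J βₖ` at a real pole `δₖ = aₖ`, with `δ₁ = 0`. -/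
def Residues.realForm (S : Residues p q) (k : Fin p) : Matrix (Fin 2) (Fin 2) ℝ :=
  (-(S.a k)) • (J * S.β k)

/-- The complex symmetric matrix `(δ₁ - δ) J β` at the nonreal pole `δ = cₗ`, with `δ₁ = 0`. -/
def Residues.complexForm (S : Residues p q) (l : Fin q) : Matrix (Fin 2) (Fin 2) ℂ :=
  (-(S.c l)) • (J.map Complex.ofReal * S.γ l)

/-- For a pair of nonreal poles and `M` the complex symmetric matrix at one of them, the real
symmetric matrix, in the coordinates `(u, v)`, of the real quadratic form
`wᵀ M w + conj (wᵀ M w)` in `w = u + i v ∈ ℂ²`. -/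
def Residues.pairForm (S : Residues p q) (l : Fin q) :
    Matrix (Fin 2 ⊕ Fin 2) (Fin 2 ⊕ Fin 2) ℝ :=
  (2 : ℝ) • Matrix.fromBlocks
    ((S.complexForm l).map Complex.re) (-(S.complexForm l).map Complex.im)
    (-(S.complexForm l).map Complex.im) (-(S.complexForm l).map Complex.re)

/-- Indices of the poles other than `δ₁`: the `p` real ones and the `2 q` nonreal ones. -/
abbrev PoleIdx (p q : ℕ) : Type := Fin p ⊕ (Fin q × Fin 2)

/-- Coordinates of the vectors in `ℝ ^ (2 (p + 2 q))`: two for each pole other than `δ₁`. -/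
abbrev VecIdx (p q : ℕ) : Type := Fin 2 × PoleIdx p q

/-- `s` is a choice of signature blocks `σₖ`, one for each pole other than `δ₁`: at a real pole
the block is congruent to `(δ₁ - δₖ) J βₖ`, and the two blocks of a pair of conjugate poles
together are congruent to the real form of that pair. -/
def Residues.IsSignature (S : Residues p q) (s : PoleIdx p q → Matrix (Fin 2) (Fin 2) ℝ) : Prop :=
  (∀ k, s k ∈ signatureBlocks) ∧
  (∀ k : Fin p, Congruent (s (Sum.inl k)) (S.realForm k)) ∧
  (∀ l : Fin q, Congruent
    (Matrix.fromBlocks (s (Sum.inr (l, 0))) 0 0 (s (Sum.inr (l, 1)))) (S.pairForm l))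

/-- The constant signature matrix `σ`, the block diagonal sum of its blocks. -/
def sigma (s : PoleIdx p q → Matrix (Fin 2) (Fin 2) ℝ) : Matrix (VecIdx p q) (VecIdx p q) ℝ :=
  Matrix.blockDiagonal s

/-! ### Operators -/

/-- The measure `dx / x` on `(0, 1)`. -/
def μ : Measure ℝ := (volume.restrict (Ioo 0 1)).withDensity fun x => ENNReal.ofReal x⁻¹

/-- The real Hilbert space `L²((0, 1), dx / x)`. -/
abbrev Scalar : Type := Lp ℝ 2 μ

/-- The real Hilbert space `L²((0, 1), dx / x; ℝ ^ (2 (p + 2 q)))`. -/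
abbrev Vector (p q : ℕ) : Type := Lp (EuclideanSpace ℝ (VecIdx p q)) 2 μ

/-- The bounded operator `T` is the integral operator with kernel `K`:
`(T f)(x) = ∫ K(x, y) f(y) dy / y`, with convergent integrals. -/
def IsIntegralOperator (T : Scalar →L[ℝ] Scalar) (K : ℝ → ℝ → ℝ) : Prop :=
  ∀ f : Scalar, ∀ᵐ x ∂μ, Integrable (fun y => K x y * f y) μ ∧ T f x = ∫ y, K x y * f y ∂μ

/-- The bounded operator `Γ` is the vector Hankel operator with symbol `ψ`:
`(Γ f)(x) = ∫ ψ(x y) f(y) dy / y`, with convergent integrals. -/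
def IsHankelOperator (Γ : Scalar →L[ℝ] Vector p q)
    (ψ : ℝ → EuclideanSpace ℝ (VecIdx p q)) : Prop :=
  ∀ f : Scalar, ∀ᵐ x ∂μ,
    Integrable (fun y => f y • ψ (x * y)) μ ∧ Γ f x = ∫ y, f y • ψ (x * y) ∂μ

/-- A constant matrix, acting pointwise on vector valued functions. -/
def matrixOp (σ : Matrix (VecIdx p q) (VecIdx p q) ℝ) : Vector p q →L[ℝ] Vector p q :=
  (Matrix.toEuclideanCLM (n := VecIdx p q) (𝕜 := ℝ) σ).compLpL 2 μ

/-- Trace class operators on a Hilbert space, as those that have a nuclear expansion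
`T f = ∑ₙ ⟨uₙ, f⟩ vₙ` with `∑ₙ ‖uₙ‖ ‖vₙ‖ < ∞`. -/
def IsTraceClass {H : Type} [NormedAddCommGroup H] [InnerProductSpace ℝ H] (T : H →L[ℝ] H) :
    Prop :=
  ∃ u v : ℕ → H, Summable (fun n => ‖u n‖ * ‖v n‖) ∧
    ∀ f : H, HasSum (fun n => inner ℝ (u n) f • v n) (T f)

/-- The kernel `K(z, ζ) = √(z ζ) Z(ζ)ᵀ J Z(z) / (z - ζ)`. -/
def kernel (Z : ℝ → Fin 2 → ℝ) (z ζ : ℝ) : ℝ :=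
  √(z * ζ) * dotProduct (Z ζ) (Matrix.mulVec J (Z z)) / (z - ζ)

end SchlesingerKernel

end

noncomputable section

namespace SchlesingerKernel

variable {p q : ℕ}

/-! ### Integral operators with kernels dominated by a product of square integrable functions -/

section DominatedKernel

variable {α : Type*} [MeasurableSpace α] {ν : Measure α}

/-! The matrices `B` are traceless, so `Bᵀ J = -J B`, and the derivative of `Z(tz)ᵀ J Z(tζ)` in `t`
is `t⁻¹ Z(tz)ᵀ J (tζ B(tζ) - tz B(tz)) Z(tζ)`. In `y B(y) - x B(x)` the residue at `0` cancels, and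
at every other pole `δ` one has `y/(y-δ) - x/(x-δ) = (y-x)(-δ)/((x-δ)(y-δ))`. The forms `(-δ) J β`
therefore appear between a factor depending on `x` alone and one depending on `y` alone. A
congruence to the signature blocks is absorbed into these factors, so with `ψ(x)` built from the
vectors `√x Z(x)/(x-δ)` the derivative is a multiple of `⟨ψ(tz), σ ψ(tζ)⟩/t`. Integrating over
`(0,1)`, where `Z → 0` removes the boundary term at `0`, gives `K(z,ζ) = ∫ ⟨ψ(tz), σ ψ(tζ)⟩ dt/t`,
that is `K = Γ† σ Γ` (`kernel_eq`, `isIntegralOperator_adjoint_comp`).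

The analysis rests on one estimate, `‖ψ(x)‖ ≤ C x^κ` with `κ > 0` the positive eigenvalue of `β₁`. A
Frobenius series gives a solution of size `x^κ` (`exists_frobenius_solution`), and constancy of the
Wronskian shows that every vanishing solution is a multiple of it (`exists_eq_smul`). Since `(xy)^κ
= x^κ y^κ` and `x^κ` lies in `L²(dx/x)`, the Hankel kernel is dominated by a product `g(x) g(y)`
with `g` square integrable. This makes `Γ` bounded and Hilbert–Schmidt, justifies every use of
Fubini, and makes `Γ† σ Γ` trace class.

Signature blocks exist by diagonalizing symmetric `2 × 2` matrices over `ℝ` or `ℂ`. Positivity of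
`K` is conjugation of `σ ≥ 0` by `Γ`. -/

/-- An operator valued kernel with `‖k x y‖ ≤ g x * g y` for a square integrable `g`. -/
structure IsDominatedKernel {E F : Type*} [NormedAddCommGroup E] [NormedSpace ℝ E]
    [NormedAddCommGroup F] [NormedSpace ℝ F] (ν : Measure α) (k : α → α → E →L[ℝ] F)
    (g : α → ℝ) : Prop where
  stronglyMeasurable : StronglyMeasurable (Function.uncurry k)
  memLp : MemLp g 2 ν
  nonneg : ∀ x, 0 ≤ g x
  bound : ∀ x y, ‖k x y‖ ≤ g x * g y

/-- The square integrable majorant times the norm of a square integrable function. -/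
theorem integrable_mul_norm_Lp {E : Type*} [NormedAddCommGroup E] {g : α → ℝ}
    (hg : MemLp g 2 ν) (f : Lp E 2 ν) : Integrable (fun y => g y * ‖f y‖) ν :=
  hg.integrable_mul (Lp.memLp f).norm

/-- Cauchy–Schwarz in `L²`; it yields the operator norm bound `‖g‖²` below. -/
theorem integral_mul_norm_Lp_le {E : Type*} [NormedAddCommGroup E] {g : α → ℝ}
    (hg : MemLp g 2 ν) (f : Lp E 2 ν) : ∫ y, g y * ‖f y‖ ∂ν ≤ ‖hg.toLp g‖ * ‖f‖ := by
  have hf := (Lp.memLp f).norm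
  have h1 : ∫ y, g y * ‖f y‖ ∂ν = inner ℝ (hg.toLp g) (hf.toLp _) := by
    rw [L2.inner_def]
    apply integral_congr_ae
    filter_upwards [hg.coeFn_toLp, hf.coeFn_toLp] with y h1 h2
    rw [h1, h2]
    simp [mul_comm]
  have h2 : ‖hf.toLp _‖ = ‖f‖ := by
    rw [Lp.norm_toLp, eLpNorm_norm, Lp.norm_def]
  rw [h1, ← h2]
  exact real_inner_le_norm _ _

section Operator

variable {E F : Type*} [NormedAddCommGroup E] [NormedSpace ℝ E]
  [NormedAddCommGroup F] [NormedSpace ℝ F] {k : α → α → E →L[ℝ] F} {g : α → ℝ}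

theorem IsDominatedKernel.norm_apply_le (hk : IsDominatedKernel ν k g) (x y : α) (v : E) :
    ‖k x y v‖ ≤ g x * (g y * ‖v‖) :=
  ((k x y).le_of_opNorm_le (hk.bound x y) v).trans_eq (mul_assoc _ _ _)

theorem IsDominatedKernel.integrable (hk : IsDominatedKernel ν k g) (f : Lp E 2 ν) (x : α) :
    Integrable (fun y => k x y (f y)) ν := by
  refine ((integrable_mul_norm_Lp hk.memLp f).const_mul (g x)).mono' ?_
    (ae_of_all _ fun y => hk.norm_apply_le x y (f y))
  exact (ContinuousLinearMap.id ℝ (E →L[ℝ] F)).aestronglyMeasurable_comp₂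
    (hk.stronglyMeasurable.comp_measurable measurable_prodMk_left).aestronglyMeasurable
    (Lp.aestronglyMeasurable f)

theorem IsDominatedKernel.norm_integral_le (hk : IsDominatedKernel ν k g) (f : Lp E 2 ν) (x : α) :
    ‖∫ y, k x y (f y) ∂ν‖ ≤ (∫ y, g y * ‖f y‖ ∂ν) * g x := by
  rw [mul_comm, ← integral_const_mul]
  exact norm_integral_le_of_norm_le ((integrable_mul_norm_Lp hk.memLp f).const_mul _)
    (ae_of_all _ fun y => hk.norm_apply_le x y (f y))

theorem IsDominatedKernel.memLp_integral [SigmaFinite ν] (hk : IsDominatedKernel ν k g)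
    (f : Lp E 2 ν) : MemLp (fun x => ∫ y, k x y (f y) ∂ν) 2 ν := by
  refine MemLp.of_le_mul (c := ∫ y, g y * ‖f y‖ ∂ν) (g := g) hk.memLp ?_ ?_
  · refine AEStronglyMeasurable.integral_prod_right' (f := fun p : α × α => k p.1 p.2 (f p.2)) ?_
    exact (ContinuousLinearMap.id ℝ (E →L[ℝ] F)).aestronglyMeasurable_comp₂
      hk.stronglyMeasurable.aestronglyMeasurable (Lp.aestronglyMeasurable f).comp_snd
  · refine ae_of_all _ fun x => (hk.norm_integral_le f x).trans_eq ?_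
    rw [Real.norm_of_nonneg (hk.nonneg x)]

/-- The bounded operator on `L²` with a dominated kernel. -/
def IsDominatedKernel.operator [SigmaFinite ν] (hk : IsDominatedKernel ν k g) :
    Lp E 2 ν →L[ℝ] Lp F 2 ν :=
  LinearMap.mkContinuous
    { toFun := fun f => (hk.memLp_integral f).toLp _
      map_add' := fun f₁ f₂ => by
        rw [← MemLp.toLp_add]
        refine MemLp.toLp_congr _ _ (ae_of_all _ fun x => ?_)
        rw [Pi.add_apply, ← integral_add (hk.integrable f₁ x) (hk.integrable f₂ x)]
        refine integral_congr_ae ?_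
        filter_upwards [Lp.coeFn_add f₁ f₂] with y hy
        simp only [hy, Pi.add_apply, map_add]
      map_smul' := fun c f => by
        rw [RingHom.id_apply, ← MemLp.toLp_const_smul]
        refine MemLp.toLp_congr _ _ (ae_of_all _ fun x => ?_)
        rw [Pi.smul_apply, ← integral_smul]
        refine integral_congr_ae ?_
        filter_upwards [Lp.coeFn_smul c f] with y hy
        simp only [hy, Pi.smul_apply, map_smul] }
    (‖hk.memLp.toLp g‖ * ‖hk.memLp.toLp g‖) fun f => by
      rw [mul_right_comm]
      refine Lp.norm_le_mul_norm_of_ae_le_mul ?_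
      filter_upwards [(hk.memLp_integral f).coeFn_toLp, hk.memLp.coeFn_toLp] with x h1 h2
      simp only [LinearMap.coe_mk, AddHom.coe_mk]
      rw [h1, h2, Real.norm_of_nonneg (hk.nonneg x)]
      exact (hk.norm_integral_le f x).trans
        (mul_le_mul_of_nonneg_right (integral_mul_norm_Lp_le hk.memLp f) (hk.nonneg x))

theorem IsDominatedKernel.coeFn_operator [SigmaFinite ν] (hk : IsDominatedKernel ν k g)
    (f : Lp E 2 ν) : hk.operator f =ᵐ[ν] fun x => ∫ y, k x y (f y) ∂ν :=
  (hk.memLp_integral f).coeFn_toLp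

end Operator

section Adjoint

variable {E F : Type*} [NormedAddCommGroup E] [InnerProductSpace ℝ E] [CompleteSpace E]
  [NormedAddCommGroup F] [InnerProductSpace ℝ F] [CompleteSpace F] {k : α → α → E →L[ℝ] F}
  {g : α → ℝ}

theorem IsDominatedKernel.adjoint (hk : IsDominatedKernel ν k g) :
    IsDominatedKernel ν (fun x y => ContinuousLinearMap.adjoint (k y x)) g where
  stronglyMeasurable := (ContinuousLinearMap.adjoint (𝕜 := ℝ)
    (E := E) (F := F)).continuous.comp_stronglyMeasurable
      (hk.stronglyMeasurable.comp_measurable measurable_swap)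
  memLp := hk.memLp
  nonneg := hk.nonneg
  bound x y := by
    rw [LinearIsometryEquiv.norm_map, mul_comm]
    exact hk.bound y x

/-- Fubini, with the product of `g(x) ‖h(x)‖` and `g(y) ‖f(y)‖` as integrable majorant. -/
theorem IsDominatedKernel.operator_adjoint [SigmaFinite ν] (hk : IsDominatedKernel ν k g) :
    ContinuousLinearMap.adjoint hk.operator = hk.adjoint.operator := by
  symm
  rw [ContinuousLinearMap.eq_adjoint_iff]
  intro h f
  rw [L2.inner_def, L2.inner_def]
  have h1 : ∀ᵐ y ∂ν, inner ℝ (hk.adjoint.operator h y) (f y)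
      = ∫ x, inner ℝ (h x) (k x y (f y)) ∂ν := by
    filter_upwards [hk.adjoint.coeFn_operator h] with y hy
    rw [hy, real_inner_comm, ← integral_inner (hk.adjoint.integrable h y)]
    refine integral_congr_ae (ae_of_all _ fun x => ?_)
    simp only [ContinuousLinearMap.adjoint_inner_right]
    exact real_inner_comm _ _
  have h2 : ∀ᵐ x ∂ν, inner ℝ (h x) (hk.operator f x)
      = ∫ y, inner ℝ (h x) (k x y (f y)) ∂ν := by
    filter_upwards [hk.coeFn_operator f] with x hx
    rw [hx, ← integral_inner (hk.integrable f x)]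
  rw [integral_congr_ae h1, integral_congr_ae h2]
  refine (integral_integral_swap ?_).symm
  refine ((integrable_mul_norm_Lp hk.memLp h).mul_prod
    (integrable_mul_norm_Lp hk.memLp f)).mono' ?_ (ae_of_all _ fun p => ?_)
  · exact (Lp.aestronglyMeasurable h).comp_fst.inner
      ((ContinuousLinearMap.id ℝ (E →L[ℝ] F)).aestronglyMeasurable_comp₂
        hk.stronglyMeasurable.aestronglyMeasurable (Lp.aestronglyMeasurable f).comp_snd)
  · refine (norm_inner_le_norm _ _).trans ?_
    refine (mul_le_mul_of_nonneg_left (hk.norm_apply_le p.1 p.2 (f p.2)) (norm_nonneg _)).trans_eq ?_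
    ring

end Adjoint

section Hankel

variable {F : Type*} [NormedAddCommGroup F] [InnerProductSpace ℝ F]
  {ψ : α → α → F} {g : α → ℝ}

/-- The operator valued kernel `c ↦ c • ψ x y` of a vector valued kernel. -/
abbrev vectorKernel (ψ : α → α → F) (x y : α) : ℝ →L[ℝ] F :=
  ContinuousLinearMap.toSpanSingleton ℝ (ψ x y)

theorem isDominatedKernel_vectorKernel (hψ : StronglyMeasurable (Function.uncurry ψ))
    (hg : MemLp g 2 ν) (hg0 : ∀ x, 0 ≤ g x) (hb : ∀ x y, ‖ψ x y‖ ≤ g x * g y) :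
    IsDominatedKernel ν (vectorKernel ψ) g where
  stronglyMeasurable :=
    (ContinuousLinearMap.toSpanSingletonCLE (𝕜 := ℝ) (E := F)).continuous.comp_stronglyMeasurable hψ
  memLp := hg
  nonneg := hg0
  bound x y := by
    rw [ContinuousLinearMap.norm_toSpanSingleton]
    exact hb x y

theorem IsDominatedKernel.norm_vector_le (hk : IsDominatedKernel ν (vectorKernel ψ) g) (x y : α) :
    ‖ψ x y‖ ≤ g x * g y := by
  simpa only [ContinuousLinearMap.norm_toSpanSingleton] using hk.bound x y

theorem IsDominatedKernel.stronglyMeasurable_vector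
    (hk : IsDominatedKernel ν (vectorKernel ψ) g) :
    StronglyMeasurable (Function.uncurry ψ) := by
  convert (ContinuousLinearMap.apply ℝ F (1 : ℝ)).continuous.comp_stronglyMeasurable
    hk.stronglyMeasurable using 2 with p
  simp [Function.uncurry]

theorem IsDominatedKernel.memLp_column
    (hk : IsDominatedKernel ν (vectorKernel ψ) g) (y : α) : MemLp (fun x => ψ x y) 2 ν := by
  refine hk.memLp.of_le_mul (c := g y)
    (hk.stronglyMeasurable_vector.comp_measurable measurable_prodMk_right).aestronglyMeasurable
    (ae_of_all _ fun x => ?_)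
  rw [Real.norm_of_nonneg (hk.nonneg x), mul_comm]
  exact hk.norm_vector_le x y

theorem IsDominatedKernel.coeFn_adjoint_operator [SigmaFinite ν] [CompleteSpace F]
    (hk : IsDominatedKernel ν (vectorKernel ψ) g) (h : Lp F 2 ν) :
    ContinuousLinearMap.adjoint hk.operator h =ᵐ[ν] fun y => ∫ x, inner ℝ (ψ x y) (h x) ∂ν := by
  rw [hk.operator_adjoint]
  filter_upwards [hk.adjoint.coeFn_operator h] with y hy
  rw [hy]
  refine integral_congr_ae (ae_of_all _ fun x => ?_)
  simp only [ContinuousLinearMap.adjoint_toSpanSingleton]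
  simp

theorem IsDominatedKernel.norm_column_le
    (hk : IsDominatedKernel ν (vectorKernel ψ) g) (y : α) :
    ‖(hk.memLp_column y).toLp _‖ ≤ g y * ‖hk.memLp.toLp g‖ := by
  refine Lp.norm_le_mul_norm_of_ae_le_mul ?_
  filter_upwards [(hk.memLp_column y).coeFn_toLp, hk.memLp.coeFn_toLp] with x h1 h2
  rw [h1, h2, Real.norm_of_nonneg (hk.nonneg x), mul_comm]
  exact hk.norm_vector_le x y

/-- The adjoint of an operator with dominated kernel is Hilbert--Schmidt. -/
theorem IsDominatedKernel.sum_norm_adjoint_sq_le [SigmaFinite ν] [CompleteSpace F]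
    (hk : IsDominatedKernel ν (vectorKernel ψ) g) (M : Lp F 2 ν →L[ℝ] Lp F 2 ν) {ι : Type*}
    {e : ι → Lp F 2 ν} (he : Orthonormal ℝ e) (s : Finset ι) :
    ∑ i ∈ s, ‖ContinuousLinearMap.adjoint hk.operator (M (e i))‖ ^ 2 ≤
      ∫ y, (‖M‖ * (g y * ‖hk.memLp.toLp g‖)) ^ 2 ∂ν := by
  -- The value at `y` is the inner product of `M (e i)` with the column `ψ(·, y)`. Moving `M` onto
  -- the column leaves `e i` bare, so Bessel's inequality applies for each fixed `y`.
  have h0 : ∀ i, ∀ᵐ y ∂ν, (ContinuousLinearMap.adjoint hk.operator (M (e i)) : α → ℝ) y =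
      inner ℝ (e i) (ContinuousLinearMap.adjoint M ((hk.memLp_column y).toLp _)) := fun i => by
    filter_upwards [hk.coeFn_adjoint_operator (M (e i))] with y hy
    rw [hy, ContinuousLinearMap.adjoint_inner_right, real_inner_comm, L2.inner_def]
    refine integral_congr_ae ?_
    filter_upwards [(hk.memLp_column y).coeFn_toLp] with x hx
    rw [hx]
  have h1 : ∀ i, ‖ContinuousLinearMap.adjoint hk.operator (M (e i))‖ ^ 2 =
      ∫ y, (ContinuousLinearMap.adjoint hk.operator (M (e i)) : α → ℝ) y ^ 2 ∂ν := fun i => by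
    rw [← real_inner_self_eq_norm_sq, L2.inner_def]
    simp [sq]
  have h2 : ∀ i, Integrable
      (fun y => (ContinuousLinearMap.adjoint hk.operator (M (e i)) : α → ℝ) y ^ 2) ν :=
    fun i => (Lp.memLp _).integrable_sq
  simp_rw [h1]
  rw [← integral_finsetSum _ fun i _ => h2 i]
  refine integral_mono_ae (integrable_finsetSum _ fun i _ => h2 i) ?_ ?_
  · exact ((hk.memLp.mul_const _).const_mul _).integrable_sq
  · filter_upwards [(ae_ball_iff s.countable_toSet).2 fun i _ => h0 i] with y hy
    rw [Finset.sum_congr rfl fun i hi => by rw [hy i hi]]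
    have := he.sum_inner_products_le
      (ContinuousLinearMap.adjoint M ((hk.memLp_column y).toLp _)) (s := s)
    simp only [Real.norm_eq_abs, sq_abs] at this
    refine this.trans (pow_le_pow_left₀ (norm_nonneg _) ?_ 2)
    refine ((ContinuousLinearMap.adjoint M).le_opNorm _).trans ?_
    rw [LinearIsometryEquiv.norm_map]
    exact mul_le_mul_of_nonneg_left (hk.norm_column_le y) (norm_nonneg _)

end Hankel

end DominatedKernel

/-! ### Trace class operators -/

/-- A summable family has countable support, so an expansion over any index type can be reindexed by
`ℕ`, padding with zeros. Hilbert bases indexed by arbitrary sets can thus be used without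
separability. -/
theorem isTraceClass_of_hasSum {H : Type} [NormedAddCommGroup H] [InnerProductSpace ℝ H]
    {ι : Type*} {T : H →L[ℝ] H} (u v : ι → H) (h : Summable fun i => ‖u i‖ * ‖v i‖)
    (hT : ∀ f, HasSum (fun i => inner ℝ (u i) f • v i) (T f)) : IsTraceClass T := by
  classical
  set s := Function.support fun i => ‖u i‖ * ‖v i‖ with hs
  have hc : s.Countable := h.countable_support
  have := hc.to_subtype
  obtain ⟨φ, hφ⟩ := exists_injective_nat s
  have key : ∀ n, (∃ i, φ i = n) ∨ ¬ ∃ i, φ i = n := fun n => em _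
  refine ⟨Function.extend φ (fun i => u i) 0, Function.extend φ (fun i => v i) 0, ?_, fun f => ?_⟩
  · have h1 := ((hasSum_extend_zero hφ).2
      ((hasSum_subtype_support (f := fun i => ‖u i‖ * ‖v i‖)).2 h.hasSum)).summable
    refine h1.congr fun n => ?_
    rcases key n with ⟨i, rfl⟩ | hn
    · simp [hφ.extend_apply]
    · simp [Function.extend_apply' _ _ _ hn]
  · have h2 : HasSum (fun i : s => inner ℝ (u i) f • v i) (T f) := by
      refine (hasSum_subtype_iff_of_support_subset fun i hi => ?_).2 (hT f)
      simp only [hs, Function.mem_support, ne_eq, mul_eq_zero, norm_eq_zero, smul_eq_zero] at hi ⊢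
      rintro (h0 | h0)
      · exact hi (Or.inl (by simp [h0]))
      · exact hi (Or.inr h0)
    refine ((hasSum_extend_zero hφ).2 h2).congr_fun ?_
    intro n
    rcases key n with ⟨i, rfl⟩ | hn
    · simp [hφ.extend_apply]
    · simp [Function.extend_apply' _ _ _ hn]

/-- `A† M A` is of trace class if `A† M'` is Hilbert--Schmidt for all bounded `M'`. -/
theorem isTraceClass_adjoint_comp {H G : Type} [NormedAddCommGroup H] [InnerProductSpace ℝ H]
    [CompleteSpace H] [NormedAddCommGroup G] [InnerProductSpace ℝ G] [CompleteSpace G]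
    (A : H →L[ℝ] G) (M : G →L[ℝ] G)
    (hA : ∀ M' : G →L[ℝ] G, ∃ C, ∀ e : Set G, Orthonormal ℝ ((↑) : e → G) → ∀ s : Finset e,
      ∑ i ∈ s, ‖ContinuousLinearMap.adjoint A (M' i)‖ ^ 2 ≤ C) :
    IsTraceClass (ContinuousLinearMap.adjoint A ∘L M ∘L A) := by
  obtain ⟨w, b, hb⟩ := exists_hilbertBasis ℝ G
  have ho : Orthonormal ℝ ((↑) : w → G) := hb ▸ b.orthonormal
  have hsum : ∀ M' : G →L[ℝ] G,
      Summable fun i : w => ‖ContinuousLinearMap.adjoint A (M' i)‖ ^ 2 := fun M' => by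
    obtain ⟨C, hC⟩ := hA M'
    exact summable_of_sum_le (fun i => sq_nonneg _) (hC w ho)
  refine isTraceClass_of_hasSum (fun i : w => ContinuousLinearMap.adjoint A i)
    (fun i : w => ContinuousLinearMap.adjoint A (M i)) ?_ fun f => ?_
  · refine Summable.of_nonneg_of_le (fun i => by positivity) (fun i => ?_)
      ((hsum (ContinuousLinearMap.id ℝ G)).add (hsum M))
    simp only [ContinuousLinearMap.id_apply]
    nlinarith [sq_nonneg (‖ContinuousLinearMap.adjoint A (i : G)‖ -
      ‖ContinuousLinearMap.adjoint A (M i)‖),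
      sq_nonneg ‖ContinuousLinearMap.adjoint A (i : G)‖,
      sq_nonneg ‖ContinuousLinearMap.adjoint A (M i)‖]
  -- Expanding `A f` in the basis gives `A† M A f = ∑ ⟨A† eᵢ, f⟩ A† M eᵢ`, a nuclear expansion whose
  -- two factors are square summable.
  · have h1 := (b.hasSum_repr (A f)).mapL (ContinuousLinearMap.adjoint A ∘L M)
    refine h1.congr_fun fun i => ?_
    rw [b.repr_apply_apply, hb, map_smul, ContinuousLinearMap.adjoint_inner_left]
    rfl

/-! ### Existence of signature blocks -/

theorem Congruent.trans {n : Type} [Fintype n] [DecidableEq n] {A B C : Matrix n n ℝ}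
    (h : Congruent A B) (h' : Congruent B C) : Congruent A C := by
  obtain ⟨P, hP, rfl⟩ := h
  obtain ⟨Q, hQ, rfl⟩ := h'
  refine ⟨P * Q, by rw [Matrix.det_mul]; exact hP.mul hQ, ?_⟩
  simp only [Matrix.transpose_mul, Matrix.mul_assoc]

/-- A symmetric `2 × 2` matrix over a field of characteristic different from two is congruent to
a diagonal one. -/
theorem exists_diagonal_congruent {R : Type*} [Field R] (h2 : (2 : R) ≠ 0) (a b c : R) :
    ∃ (P : Matrix (Fin 2) (Fin 2) R) (d₁ d₂ : R), IsUnit P.det ∧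
      P.transpose * !![d₁, 0; 0, d₂] * P = !![a, b; b, c] := by
  by_cases ha : a = 0
  · by_cases hc : c = 0
    -- Hyperbolic case: `2bxy = (b/2)((x+y)² - (x-y)²)`. The other two cases complete the square.
    · refine ⟨!![1, 1; 1, -1], b / 2, -(b / 2), ?_, ?_⟩
      · rw [Matrix.det_fin_two_of, isUnit_iff_ne_zero]
        intro h
        apply h2
        linear_combination -h
      · ext i j
        fin_cases i <;> fin_cases j <;>
          simp [Matrix.mul_apply, Fin.sum_univ_two, ha, hc] <;> field_simp <;> ring
    · refine ⟨!![b / c, 1; 1, 0], c, -(b ^ 2 / c), ?_, ?_⟩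
      · simp [Matrix.det_fin_two_of]
      · ext i j
        fin_cases i <;> fin_cases j <;>
          simp [Matrix.mul_apply, Fin.sum_univ_two, ha] <;> field_simp <;> ring
  · refine ⟨!![1, b / a; 0, 1], a, c - b ^ 2 / a, ?_, ?_⟩
    · simp [Matrix.det_fin_two_of]
    · ext i j
      fin_cases i <;> fin_cases j <;>
        simp [Matrix.mul_apply, Fin.sum_univ_two] <;> field_simp <;> ring

theorem exists_sign_mul_sq (d : ℝ) :
    ∃ e r : ℝ, (e = 1 ∨ e = 0 ∨ e = -1) ∧ r ≠ 0 ∧ d = e * r ^ 2 := by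
  rcases lt_trichotomy d 0 with h | h | h
  · refine ⟨-1, √(-d), by simp, (Real.sqrt_pos.2 (by linarith)).ne', ?_⟩
    rw [Real.sq_sqrt (by linarith)]; ring
  · exact ⟨0, 1, by simp, one_ne_zero, by simp [h]⟩
  · refine ⟨1, √d, by simp, (Real.sqrt_pos.2 h).ne', ?_⟩
    rw [Real.sq_sqrt h.le]; ring

theorem diagonal_congruence {R : Type*} [Field R] (e₁ e₂ r₁ r₂ : R) :
    (!![r₁, 0; 0, r₂] : Matrix (Fin 2) (Fin 2) R).transpose * !![e₁, 0; 0, e₂] *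
      !![r₁, 0; 0, r₂] = !![e₁ * r₁ ^ 2, 0; 0, e₂ * r₂ ^ 2] := by
  ext i j
  fin_cases i <;> fin_cases j <;> simp [Matrix.mul_apply, Fin.sum_univ_two] <;> ring

/-- The list of blocks fixes an order of the diagonal entries, for instance it has `diag(1,0)` but
not `diag(0,1)`; exchanging coordinates reaches the listed order. -/
theorem swapped_diagonal_congruence {R : Type*} [Field R] (e₁ e₂ r₁ r₂ : R) :
    (!![0, r₂; r₁, 0] : Matrix (Fin 2) (Fin 2) R).transpose * !![e₂, 0; 0, e₁] *
      !![0, r₂; r₁, 0] = !![e₁ * r₁ ^ 2, 0; 0, e₂ * r₂ ^ 2] := by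
  ext i j
  fin_cases i <;> fin_cases j <;> simp [Matrix.mul_apply, Fin.sum_univ_two] <;> ring

theorem exists_signatureBlock_congruent (a b c : ℝ) :
    ∃ s ∈ signatureBlocks, Congruent s !![a, b; b, c] := by
  obtain ⟨P, d₁, d₂, hP, h⟩ := exists_diagonal_congruent (two_ne_zero : (2 : ℝ) ≠ 0) a b c
  obtain ⟨e₁, r₁, he₁, hr₁, rfl⟩ := exists_sign_mul_sq d₁
  obtain ⟨e₂, r₂, he₂, hr₂, rfl⟩ := exists_sign_mul_sq d₂
  have h1 : Congruent !![e₁, 0; 0, e₂] !![a, b; b, c] :=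
    Congruent.trans ⟨_, by simp [Matrix.det_fin_two_of, hr₁, hr₂],
      diagonal_congruence e₁ e₂ r₁ r₂⟩ ⟨P, hP, h⟩
  have h2 : Congruent !![e₂, 0; 0, e₁] !![a, b; b, c] :=
    Congruent.trans ⟨_, by simp [Matrix.det_fin_two_of, hr₁, hr₂],
      swapped_diagonal_congruence e₁ e₂ r₁ r₂⟩ ⟨P, hP, h⟩
  have hz : (!![0, 0; 0, 0] : Matrix (Fin 2) (Fin 2) ℝ) = 0 := by
    ext i j; fin_cases i <;> fin_cases j <;> rfl
  rcases he₁ with rfl | rfl | rfl <;> rcases he₂ with rfl | rfl | rfl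
  · exact ⟨_, by simp [signatureBlocks], h1⟩
  · exact ⟨_, by simp [signatureBlocks], h1⟩
  · exact ⟨_, by simp [signatureBlocks], h1⟩
  · exact ⟨_, by simp [signatureBlocks], h2⟩
  · exact ⟨_, by simp [signatureBlocks, hz], h1⟩
  · exact ⟨_, by simp [signatureBlocks], h2⟩
  · exact ⟨_, by simp [signatureBlocks], h2⟩
  · exact ⟨_, by simp [signatureBlocks], h1⟩
  · exact ⟨_, by simp [signatureBlocks], h1⟩

/-! ### Nonreal poles: from complex congruence to real congruence -/

/-- The real `4 × 4` matrix of a complex `2 × 2` matrix. -/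
def realify (P : Matrix (Fin 2) (Fin 2) ℂ) : Matrix (Fin 2 ⊕ Fin 2) (Fin 2 ⊕ Fin 2) ℝ :=
  Matrix.fromBlocks (P.map Complex.re) (-P.map Complex.im) (P.map Complex.im) (P.map Complex.re)

theorem realify_mul (P Q : Matrix (Fin 2) (Fin 2) ℂ) :
    realify (P * Q) = realify P * realify Q := by
  rw [realify, realify, realify, Matrix.fromBlocks_multiply]
  congr 1 <;> ext i j <;> simp [Matrix.mul_apply, Fin.sum_univ_two] <;> ring

theorem realify_one : realify 1 = 1 := by
  rw [realify, ← Matrix.fromBlocks_one]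
  congr 1 <;> ext i j <;> fin_cases i <;> fin_cases j <;> simp

theorem isUnit_det_realify {P : Matrix (Fin 2) (Fin 2) ℂ} (hP : IsUnit P.det) :
    IsUnit (realify P).det :=
  IsUnit.of_mul_eq_one (realify P⁻¹).det (by
    rw [← Matrix.det_mul, ← realify_mul, Matrix.mul_nonsing_inv _ hP, realify_one,
      Matrix.det_one])

/-- For real `D` and `w = u + iv`, `2 Re(wᵀ D w) = 2(uᵀ D u - vᵀ D v)`, so the real form of `D` is
`2 diag(D, -D)`. A complex change of variable acts on `(u, v)` through `realify`, and the factor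
`√2` absorbs the `2`. -/
theorem congruent_realForm_of_complex (D : Matrix (Fin 2) (Fin 2) ℝ)
    (P M : Matrix (Fin 2) (Fin 2) ℂ) (hP : IsUnit P.det)
    (h : P.transpose * D.map Complex.ofReal * P = M) :
    Congruent (Matrix.fromBlocks D 0 0 (-D)) ((2 : ℝ) • Matrix.fromBlocks
      (M.map Complex.re) (-M.map Complex.im) (-M.map Complex.im) (-M.map Complex.re)) := by
  refine ⟨√2 • realify P, ?_, ?_⟩
  · rw [Matrix.det_smul]
    exact (IsUnit.mk0 _ (by positivity)).mul (isUnit_det_realify hP)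
  · rw [Matrix.transpose_smul, Matrix.smul_mul, Matrix.smul_mul, Matrix.mul_smul, smul_smul,
      Real.mul_self_sqrt zero_le_two, realify, Matrix.fromBlocks_transpose,
      Matrix.fromBlocks_multiply, Matrix.fromBlocks_multiply, ← h]
    congr 2 <;> ext i j <;> simp [Matrix.mul_apply, Fin.sum_univ_two] <;> ring

theorem exists_signatureBlock_congruent_complex (a b c : ℂ) :
    ∃ (D : Matrix (Fin 2) (Fin 2) ℝ) (P : Matrix (Fin 2) (Fin 2) ℂ), D ∈ signatureBlocks ∧
      -D ∈ signatureBlocks ∧ IsUnit P.det ∧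
      P.transpose * D.map Complex.ofReal * P = !![a, b; b, c] := by
  obtain ⟨P, d₁, d₂, hP, h⟩ := exists_diagonal_congruent (two_ne_zero : (2 : ℂ) ≠ 0) a b c
  -- Over `ℂ` every nonzero number is a square, so only the rank of the form survives and no signs
  -- are needed.
  have key : ∀ d : ℂ, ∃ (e : ℝ) (r : ℂ), (e = 1 ∨ e = 0) ∧ r ≠ 0 ∧ d = (e : ℂ) * r ^ 2 := by
    intro d
    by_cases hd : d = 0
    · exact ⟨0, 1, by simp, one_ne_zero, by simp [hd]⟩
    · obtain ⟨r, hr⟩ := IsAlgClosed.exists_pow_nat_eq d zero_lt_two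
      refine ⟨1, r, by simp, ?_, by simp [hr]⟩
      rintro rfl
      exact hd (by simpa using hr.symm)
  obtain ⟨e₁, r₁, he₁, hr₁, rfl⟩ := key d₁
  obtain ⟨e₂, r₂, he₂, hr₂, rfl⟩ := key d₂
  have hmap : ∀ x y : ℝ, (!![x, 0; 0, y] : Matrix (Fin 2) (Fin 2) ℝ).map Complex.ofReal =
      !![(x : ℂ), 0; 0, (y : ℂ)] := fun x y => by
    ext i j; fin_cases i <;> fin_cases j <;> simp
  have h1 : ∃ P : Matrix (Fin 2) (Fin 2) ℂ, IsUnit P.det ∧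
      P.transpose * (!![e₁, 0; 0, e₂] : Matrix (Fin 2) (Fin 2) ℝ).map Complex.ofReal * P =
        !![a, b; b, c] := by
    refine ⟨!![r₁, 0; 0, r₂] * P, ?_, ?_⟩
    · rw [Matrix.det_mul]
      exact IsUnit.mul (by simp [Matrix.det_fin_two_of, hr₁, hr₂]) hP
    · rw [← h, ← diagonal_congruence, hmap]
      simp only [Matrix.transpose_mul, Matrix.mul_assoc]
  have h2 : ∃ P : Matrix (Fin 2) (Fin 2) ℂ, IsUnit P.det ∧
      P.transpose * (!![e₂, 0; 0, e₁] : Matrix (Fin 2) (Fin 2) ℝ).map Complex.ofReal * P =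
        !![a, b; b, c] := by
    refine ⟨!![0, r₂; r₁, 0] * P, ?_, ?_⟩
    · rw [Matrix.det_mul]
      exact IsUnit.mul (by simp [Matrix.det_fin_two_of, hr₁, hr₂]) hP
    · rw [← h, ← swapped_diagonal_congruence, hmap]
      simp only [Matrix.transpose_mul, Matrix.mul_assoc]
  have hz : (!![0, 0; 0, 0] : Matrix (Fin 2) (Fin 2) ℝ) = 0 := by
    ext i j; fin_cases i <;> fin_cases j <;> rfl
  obtain ⟨P₁, hP₁, h1⟩ := h1
  obtain ⟨P₂, hP₂, h2⟩ := h2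
  rcases he₁ with rfl | rfl <;> rcases he₂ with rfl | rfl
  · exact ⟨_, P₁, by simp [signatureBlocks], by simp [signatureBlocks], hP₁, h1⟩
  · exact ⟨_, P₁, by simp [signatureBlocks], by simp [signatureBlocks], hP₁, h1⟩
  · exact ⟨_, P₂, by simp [signatureBlocks], by simp [signatureBlocks], hP₂, h2⟩
  · exact ⟨_, P₁, by simp [signatureBlocks, hz], by simp [signatureBlocks, hz], hP₁, h1⟩

theorem trace_traceless {R : Type} [Field R] (h2 : (2 : R) ≠ 0) (α : Matrix (Fin 2) (Fin 2) R) :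
    (traceless α).trace = 0 := by
  simp [traceless, Matrix.trace_fin_two]
  field_simp
  ring

theorem Residues.trace_β₁ (S : Residues p q) : S.β₁.trace = 0 := trace_traceless two_ne_zero _

theorem Residues.trace_β (S : Residues p q) (k : Fin p) : (S.β k).trace = 0 :=
  trace_traceless two_ne_zero _

theorem Residues.trace_γ (S : Residues p q) (l : Fin q) : (S.γ l).trace = 0 :=
  trace_traceless two_ne_zero _

theorem Residues.exists_isSignature (S : Residues p q) : ∃ s, S.IsSignature s := by
  have h1 : ∀ k : Fin p, ∃ s ∈ signatureBlocks, Congruent s (S.realForm k) := fun k => by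
    have ht := S.trace_β k
    rw [Matrix.trace_fin_two] at ht
    convert exists_signatureBlock_congruent (S.a k * S.β k 1 0) (-S.a k * S.β k 0 0)
      (-S.a k * S.β k 0 1)
    ext i j
    fin_cases i <;> fin_cases j <;>
      simp [Residues.realForm, J, Matrix.vecMul, dotProduct, Fin.sum_univ_two]
    -- The off-diagonal entries of `J β` agree exactly because `β` has trace zero.
    linear_combination (S.a k) * ht
  have h2 : ∀ l : Fin q, ∃ D ∈ signatureBlocks, -D ∈ signatureBlocks ∧
      Congruent (Matrix.fromBlocks D 0 0 (-D)) (S.pairForm l) := fun l => by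
    have ht := S.trace_γ l
    rw [Matrix.trace_fin_two] at ht
    obtain ⟨D, P, hD, hD', hP, h⟩ := exists_signatureBlock_congruent_complex
      (S.c l * S.γ l 1 0) (-S.c l * S.γ l 0 0) (-S.c l * S.γ l 0 1)
    refine ⟨D, hD, hD', congruent_realForm_of_complex D P (S.complexForm l) hP (h.trans ?_)⟩
    ext i j
    fin_cases i <;> fin_cases j <;>
      simp [Residues.complexForm, J, Matrix.mul_apply, Fin.sum_univ_two]
    linear_combination -(S.c l) * ht
  choose s hs hs' using h1
  choose D hD hD' hDc using h2
  refine ⟨Sum.elim s fun i => if i.2 = 0 then D i.1 else -D i.1, ?_, hs', hDc⟩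
  rintro (k | ⟨l, i⟩)
  · exact hs k
  · fin_cases i
    · exact hD l
    · exact hD' l

/-! ### Constant matrices as operators -/

/-- Symmetry and nonnegativity hold pointwise in `x` and are integrated. -/
theorem matrixOp_isPositive {σ : Matrix (VecIdx p q) (VecIdx p q) ℝ} (h : σ.PosSemidef) :
    (matrixOp σ).IsPositive := by
  have hc : ∀ u : Vector p q, matrixOp σ u =ᵐ[μ]
      fun x => Matrix.toEuclideanCLM (n := VecIdx p q) (𝕜 := ℝ) σ (u x) :=
    fun u => ContinuousLinearMap.coeFn_compLpL _ u
  have hsym : ∀ u v : EuclideanSpace ℝ (VecIdx p q),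
      inner ℝ (Matrix.toEuclideanCLM (n := VecIdx p q) (𝕜 := ℝ) σ u) v =
        inner ℝ u (Matrix.toEuclideanCLM (n := VecIdx p q) (𝕜 := ℝ) σ v) := fun u v => by
    have := (map_star (Matrix.toEuclideanCLM (n := VecIdx p q) (𝕜 := ℝ)) σ)
    rw [Matrix.star_eq_conjTranspose, h.isHermitian.eq] at this
    conv_lhs => rw [this, ContinuousLinearMap.star_eq_adjoint]
    exact ContinuousLinearMap.adjoint_inner_left _ _ _
  have hnn : ∀ u : EuclideanSpace ℝ (VecIdx p q),
      0 ≤ inner ℝ (Matrix.toEuclideanCLM (n := VecIdx p q) (𝕜 := ℝ) σ u) u := fun u => by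
    have := h.dotProduct_mulVec_nonneg u.ofLp
    rw [EuclideanSpace.inner_eq_star_dotProduct]
    simpa [Matrix.ofLp_toEuclideanCLM] using this
  refine ⟨fun u v => ?_, fun u => ?_⟩
  · simp only [ContinuousLinearMap.coe_coe]
    rw [L2.inner_def, L2.inner_def]
    refine integral_congr_ae ?_
    filter_upwards [hc u, hc v] with x hu hv
    rw [hu, hv, hsym]
  · rw [ContinuousLinearMap.reApplyInnerSelf_apply, L2.inner_def]
    refine integral_nonneg_of_ae ?_
    filter_upwards [hc u] with x hu
    rw [hu]
    exact hnn _

/-! ### Solutions of linear systems at a simple pole -/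

section Frobenius

variable {E : Type*} [NormedAddCommGroup E] [NormedSpace ℝ E]

/-- The integral operator that inverts `W ↦ W' - x⁻¹ (P W - κ W)` when `P` has the
eigenvalues `κ, -κ` with eigenprojections `P₁, P₂`. -/
def volterra (κ : ℝ) (P₁ P₂ : E →L[ℝ] E) (f : ℝ → E) (x : ℝ) : E :=
  P₁ (∫ t in (0 : ℝ)..x, f t) + (x ^ (2 * κ))⁻¹ • P₂ (∫ t in (0 : ℝ)..x, t ^ (2 * κ) • f t)

/-- On `(0, x]` the weight `t^(2κ)/x^(2κ)` is at most `1`, so the singular component obeys the same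
estimate as plain integration. The gain `1/(n+1)` produces the factorial in the Neumann series. -/
theorem norm_volterra_le {κ : ℝ} (hκ : 0 < κ) (P₁ P₂ : E →L[ℝ] E) {f : ℝ → E} {x c : ℝ} {n : ℕ}
    (hx : 0 ≤ x) (hf : ∀ t ∈ Ioc 0 x, ‖f t‖ ≤ c * t ^ n) :
    ‖volterra κ P₁ P₂ f x‖ ≤ (‖P₁‖ + ‖P₂‖) * (c * (x ^ (n + 1) / (n + 1))) := by
  have hI : ∫ t in (0 : ℝ)..x, c * t ^ n = c * (x ^ (n + 1) / (n + 1)) := by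
    rw [intervalIntegral.integral_const_mul, integral_pow]
    simp
  have hint : IntervalIntegrable (fun t => c * t ^ n) volume 0 x :=
    (by fun_prop : Continuous fun t : ℝ => c * t ^ n).intervalIntegrable _ _
  have h1 : ‖∫ t in (0 : ℝ)..x, f t‖ ≤ c * (x ^ (n + 1) / (n + 1)) := by
    rw [← hI]
    exact intervalIntegral.norm_integral_le_of_norm_le hx (ae_of_all _ hf) hint
  have h2 : ‖∫ t in (0 : ℝ)..x, t ^ (2 * κ) • f t‖ ≤
      x ^ (2 * κ) * (c * (x ^ (n + 1) / (n + 1))) := by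
    rw [← hI, ← intervalIntegral.integral_const_mul]
    refine intervalIntegral.norm_integral_le_of_norm_le hx (ae_of_all _ fun t ht => ?_)
      (hint.const_mul _)
    rw [norm_smul, Real.norm_of_nonneg (Real.rpow_nonneg ht.1.le _)]
    have h0 : 0 ≤ c * t ^ n := (norm_nonneg _).trans (hf t ht)
    exact mul_le_mul (Real.rpow_le_rpow ht.1.le ht.2 (by positivity)) (hf t ht) (norm_nonneg _)
      (Real.rpow_nonneg hx _)
  rw [add_mul]
  refine (norm_add_le _ _).trans (add_le_add (P₁.le_opNorm_of_le h1) ?_)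
  rw [norm_smul, norm_inv, Real.norm_of_nonneg (Real.rpow_nonneg hx _)]
  rcases hx.eq_or_lt with rfl | hx
  · simp
  · have hp := Real.rpow_pos_of_pos hx (2 * κ)
    rw [inv_mul_le_iff₀ hp]
    refine (P₂.le_opNorm_of_le h2).trans_eq ?_
    ring

/-- Terms of the Neumann series of a Frobenius solution. -/
def frobeniusTerm (κ : ℝ) (P₁ P₂ : E →L[ℝ] E) (R : ℝ → E →L[ℝ] E) (v : E) : ℕ → ℝ → E
  | 0 => fun _ => v
  | n + 1 => volterra κ P₁ P₂ fun t => R t (frobeniusTerm κ P₁ P₂ R v n t)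

theorem norm_frobeniusTerm_le {κ b ρ : ℝ} (hκ : 0 < κ) (P₁ P₂ : E →L[ℝ] E)
    {R : ℝ → E →L[ℝ] E} (hR : ∀ t ∈ Icc 0 b, ‖R t‖ ≤ ρ) (v : E) (n : ℕ) :
    ∀ x ∈ Icc 0 b, ‖frobeniusTerm κ P₁ P₂ R v n x‖ ≤
      (((‖P₁‖ + ‖P₂‖) * ρ) ^ n / n.factorial * ‖v‖) * x ^ n := by
  induction n with
  | zero => intro x _; simp [frobeniusTerm]
  | succ n ih =>
    intro x hx
    refine (norm_volterra_le hκ P₁ P₂ (n := n)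
      (c := ρ * (((‖P₁‖ + ‖P₂‖) * ρ) ^ n / n.factorial * ‖v‖)) hx.1 fun t ht => ?_).trans_eq ?_
    · have ht' : t ∈ Icc 0 b := ⟨ht.1.le, ht.2.trans hx.2⟩
      rw [mul_assoc]
      exact (R t).le_of_opNorm_le_of_le (hR t ht') (ih t ht')
    · rw [Nat.factorial_succ]
      push_cast
      field_simp
      ring

theorem continuousOn_rpow_smul {κ d : ℝ} (hκ : 0 < κ) {f : ℝ → E}
    (hf : ContinuousOn f (Ico 0 d)) : ContinuousOn (fun t => t ^ (2 * κ) • f t) (Ico 0 d) :=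
  (Real.continuous_rpow_const (by positivity)).continuousOn.smul hf

variable [CompleteSpace E]

theorem hasDerivAt_integral_of_continuousOn {d x : ℝ} {f : ℝ → E}
    (hf : ContinuousOn f (Ico 0 d)) (hx : x ∈ Ioo 0 d) :
    HasDerivAt (fun y => ∫ t in (0 : ℝ)..y, f t) (f x) x := by
  refine intervalIntegral.integral_hasDerivAt_right ?_ ?_ ?_
  · refine ContinuousOn.intervalIntegrable (hf.mono ?_)
    rw [uIcc_of_le hx.1.le]
    exact fun t ht => ⟨ht.1, ht.2.trans_lt hx.2⟩
  · exact (hf.mono Ioo_subset_Ico_self).stronglyMeasurableAtFilter isOpen_Ioo x hx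
  · exact (hf.mono Ioo_subset_Ico_self).continuousAt (Ioo_mem_nhds hx.1 hx.2)

/-- On the `κ`-eigenspace the equation for `W` is `W' = f`; on the `-κ`-eigenspace it is `W' +
(2κ/x) W = f`, with integrating factor `x^(2κ)`. The two components of `volterra` solve these. -/
theorem hasDerivAt_volterra {κ d x : ℝ} (hκ : 0 < κ) {A P₁ P₂ : E →L[ℝ] E}
    (hsum : ∀ v, P₁ v + P₂ v = v) (hA₁ : ∀ v, A (P₁ v) = κ • P₁ v)
    (hA₂ : ∀ v, A (P₂ v) = -κ • P₂ v) {f : ℝ → E} (hf : ContinuousOn f (Ico 0 d))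
    (hx : x ∈ Ioo 0 d) :
    HasDerivAt (volterra κ P₁ P₂ f) (f x + x⁻¹ •
      (A (volterra κ P₁ P₂ f x) - κ • volterra κ P₁ P₂ f x)) x := by
  have h1 := P₁.hasFDerivAt.comp_hasDerivAt x (hasDerivAt_integral_of_continuousOn hf hx)
  have h2 := P₂.hasFDerivAt.comp_hasDerivAt x (hasDerivAt_integral_of_continuousOn
    (continuousOn_rpow_smul hκ hf) hx)
  have hp := Real.rpow_pos_of_pos hx.1 (2 * κ)
  have h3 : HasDerivAt (fun y : ℝ => (y ^ (2 * κ))⁻¹) (-(2 * κ) * x⁻¹ * (x ^ (2 * κ))⁻¹) x := by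
    refine ((Real.hasDerivAt_rpow_const (p := 2 * κ) (Or.inl hx.1.ne')).fun_inv
      hp.ne').congr_deriv ?_
    rw [Real.rpow_sub_one hx.1.ne']
    field_simp
  refine HasDerivAt.congr_deriv (f := volterra κ P₁ P₂ f) (h1.fun_add (h3.fun_smul h2)) ?_
  simp only [volterra, map_add, map_smul, hA₁, hA₂, smul_add, smul_sub,
    smul_smul]
  set I := ∫ t in (0 : ℝ)..x, f t
  set I' := ∫ t in (0 : ℝ)..x, t ^ (2 * κ) • f t
  rw [inv_mul_cancel₀ hp.ne', one_smul]
  rw [← sub_eq_of_eq_add' (hsum (f x)).symm]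
  module

/-- Away from `0` this is differentiability; at `0` the estimate with exponent `n = 0` bounds the
value by a multiple of `x`. Continuity up to `0` is what lets the iteration proceed. -/
theorem continuousOn_volterra {κ d : ℝ} (hκ : 0 < κ) {A P₁ P₂ : E →L[ℝ] E}
    (hsum : ∀ v, P₁ v + P₂ v = v) (hA₁ : ∀ v, A (P₁ v) = κ • P₁ v)
    (hA₂ : ∀ v, A (P₂ v) = -κ • P₂ v) {f : ℝ → E} (hf : ContinuousOn f (Ico 0 d)) :
    ContinuousOn (volterra κ P₁ P₂ f) (Ico 0 d) := by
  intro x hx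
  rcases hx.1.eq_or_lt with rfl | h0
  · have hb : ∀ᶠ t in 𝓝[Ico 0 d] (0 : ℝ), ‖f t‖ < ‖f 0‖ + 1 :=
      (hf 0 hx).norm.eventually_lt_const (by linarith)
    obtain ⟨r, hr, hb⟩ := (Metric.nhdsWithin_basis_ball.eventually_iff).1 hb
    have h00 : volterra κ P₁ P₂ f 0 = 0 := by simp [volterra]
    rw [ContinuousWithinAt, h00]
    refine squeeze_zero_norm' (a := fun x => (‖P₁‖ + ‖P₂‖) * ((‖f 0‖ + 1) * (x ^ (0 + 1) /
      ((0 : ℕ) + 1)))) ?_ ?_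
    · filter_upwards [self_mem_nhdsWithin, mem_nhdsWithin_of_mem_nhds (Metric.ball_mem_nhds 0 hr)]
        with y hy hyr
      refine norm_volterra_le hκ P₁ P₂ hy.1 fun t ht => ?_
      rw [pow_zero, mul_one]
      refine (hb ⟨?_, ht.1.le, ht.2.trans_lt hy.2⟩).le
      rw [mem_ball_zero_iff, Real.norm_of_nonneg hy.1] at hyr
      rw [mem_ball_zero_iff, Real.norm_of_nonneg ht.1.le]
      exact ht.2.trans_lt hyr
    · refine ((Continuous.tendsto' ?_ _ _ ?_).mono_left nhdsWithin_le_nhds)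
      · fun_prop
      · simp
  · exact (hasDerivAt_volterra hκ hsum hA₁ hA₂ hf ⟨h0, hx.2⟩).continuousAt.continuousWithinAt

theorem continuousOn_frobeniusTerm {κ d : ℝ} (hκ : 0 < κ) {A P₁ P₂ : E →L[ℝ] E}
    (hsum : ∀ v, P₁ v + P₂ v = v) (hA₁ : ∀ v, A (P₁ v) = κ • P₁ v)
    (hA₂ : ∀ v, A (P₂ v) = -κ • P₂ v) {R : ℝ → E →L[ℝ] E} (hR : ContinuousOn R (Ico 0 d)) (v : E)
    (n : ℕ) : ContinuousOn (frobeniusTerm κ P₁ P₂ R v n) (Ico 0 d) := by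
  induction n with
  | zero => exact continuousOn_const
  | succ n ih => exact continuousOn_volterra hκ hsum hA₁ hA₂ (hR.clm_apply ih)

/-- A linear system with a simple pole at `0`, whose residue has the eigenvalues `κ > 0` and `-κ`,
has a solution that behaves like `x ^ κ` at `0`. -/
theorem exists_frobenius_solution {κ d : ℝ} (hκ : 0 < κ) (hd : 0 < d) {A : E →L[ℝ] E}
    (hA : ∀ v, A (A v) = κ ^ 2 • v) {R : ℝ → E →L[ℝ] E} (hR : ContinuousOn R (Ico 0 d)) {v : E}
    (hv : A v = κ • v) :
    ∃ W : ℝ → E, ContinuousOn W (Ico 0 d) ∧ W 0 = v ∧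
      ∀ x ∈ Ioo 0 d, HasDerivAt (fun y => y ^ κ • W y)
        (x⁻¹ • A (x ^ κ • W x) + R x (x ^ κ • W x)) x := by
  -- Since `A² = κ²`, these are the spectral projections of `A` for `κ` and `-κ`. The solution is
  -- sought as `x^κ W`, where `W' = x⁻¹ (A - κ) W + R W`.
  set P₁ : E →L[ℝ] E := (2 * κ)⁻¹ • (A + κ • ContinuousLinearMap.id ℝ E) with hP₁
  set P₂ : E →L[ℝ] E := (2 * κ)⁻¹ • (κ • ContinuousLinearMap.id ℝ E - A) with hP₂
  have hsum : ∀ v, P₁ v + P₂ v = v := fun v => by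
    simp only [hP₁, hP₂, smul_apply, add_apply,
      sub_apply, ContinuousLinearMap.id_apply]
    match_scalars <;> field_simp <;> norm_num
  have hA₁ : ∀ v, A (P₁ v) = κ • P₁ v := fun v => by
    simp only [hP₁, smul_apply, add_apply,
      ContinuousLinearMap.id_apply, map_smul, map_add, hA]
    module
  have hA₂ : ∀ v, A (P₂ v) = -κ • P₂ v := fun v => by
    simp only [hP₂, smul_apply, sub_apply,
      ContinuousLinearMap.id_apply, map_smul, map_sub, hA]
    module
  set w := frobeniusTerm κ P₁ P₂ R v with hw
  -- The derivative of term `n + 1` contains `R` applied to term `n`. This shift by one makes the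
  -- summed derivatives equal `R W + x⁻¹ (A - κ) W`.
  set w' : ℕ → ℝ → E := fun n x => Nat.casesOn n 0 (fun m => R x (w m x)) +
    x⁻¹ • (A (w n x) - κ • w n x) with hw'
  have hcont : ∀ n, ContinuousOn (w n) (Ico 0 d) :=
    continuousOn_frobeniusTerm hκ hsum hA₁ hA₂ hR v
  have hderiv : ∀ n, ∀ x ∈ Ioo 0 d, HasDerivAt (w n) (w' n x) x := by
    rintro (_ | n) x hx
    · simpa [hw, hw', frobeniusTerm, hv] using hasDerivAt_const x v
    · exact hasDerivAt_volterra hκ hsum hA₁ hA₂ (hR.clm_apply (hcont n)) hx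
  have hbound : ∀ b ∈ Ioo 0 d, ∃ ρ ≥ 0, ∃ u : ℕ → ℝ, Summable u ∧ (∀ t ∈ Icc 0 b, ‖R t‖ ≤ ρ) ∧
      ∀ n, ∀ x ∈ Icc 0 b, ‖w n x‖ ≤ u n := fun b hb => by
    obtain ⟨ρ, hρ⟩ := isCompact_Icc.exists_bound_of_continuousOn
      (hR.mono fun t (ht : t ∈ Icc 0 b) => ⟨ht.1, ht.2.trans_lt hb.2⟩)
    have hρ0 : 0 ≤ ρ := (norm_nonneg _).trans (hρ 0 ⟨le_rfl, hb.1.le⟩)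
    refine ⟨ρ, hρ0, fun n => ((‖P₁‖ + ‖P₂‖) * ρ * b) ^ n / n.factorial * ‖v‖,
      (Real.summable_pow_div_factorial _).mul_right _, hρ, fun n x hx => ?_⟩
    refine (norm_frobeniusTerm_le hκ P₁ P₂ hρ v n x hx).trans ?_
    have h1 : x ^ n ≤ b ^ n := pow_le_pow_left₀ hx.1 hx.2 n
    refine (mul_le_mul_of_nonneg_left h1 (by positivity)).trans_eq ?_
    simp only [mul_pow]
    ring
  -- `R` need not be bounded near `d`, so the series is controlled on `[0, b]` with `b` halfway
  -- between `x` and `d`.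
  have hmid : ∀ x ∈ Ico 0 d, (x + d) / 2 ∈ Ioo 0 d ∧ x < (x + d) / 2 := fun x hx =>
    ⟨⟨by linarith [hx.1], by linarith [hx.2]⟩, by linarith [hx.2]⟩
  have hsummable : ∀ x ∈ Ico 0 d, Summable fun n => w n x := fun x hx => by
    obtain ⟨ρ, -, u, hu, -, hwu⟩ := hbound _ (hmid x hx).1
    exact hu.of_norm_bounded fun n => hwu n x ⟨hx.1, (hmid x hx).2.le⟩
  refine ⟨fun x => ∑' n, w n x, fun x hx => ?_, ?_, fun x hx => ?_⟩
  · obtain ⟨ρ, -, u, hu, -, hwu⟩ := hbound _ (hmid x hx).1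
    have hc : ContinuousOn (fun x => ∑' n, w n x) (Ico 0 ((x + d) / 2)) :=
      continuousOn_tsum (fun n => (hcont n).mono (Ico_subset_Ico_right (hmid x hx).1.2.le)) hu
        fun n y hy => hwu n y (Ico_subset_Icc_self hy)
    refine (hc x ⟨hx.1, (hmid x hx).2⟩).mono_of_mem_nhdsWithin ?_
    filter_upwards [self_mem_nhdsWithin, mem_nhdsWithin_of_mem_nhds (Iio_mem_nhds (hmid x hx).2)]
      with y hy hy'
    exact ⟨hy.1, hy'⟩
  · refine (tsum_eq_single 0 ?_).trans ?_
    · rintro (_ | n) hn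
      · exact absurd rfl hn
      · simp [hw, frobeniusTerm, volterra]
    · rfl
  · have hx' : x ∈ Ico 0 d := Ioo_subset_Ico_self hx
    set b := (x + d) / 2
    obtain ⟨ρ, hρ, u, hu, hRρ, hwu⟩ := hbound _ (hmid x hx').1
    -- Termwise differentiation is done on `(x/2, b)`: staying away from `0` keeps the factor `y⁻¹`
    -- bounded.
    have hab : x / 2 < x := by linarith [hx.1]
    have hxb : x ∈ Ioo (x / 2) b := ⟨hab, (hmid x hx').2⟩
    have hsub : ∀ y ∈ Ioo (x / 2) b, y ∈ Ioo 0 d := fun y hy =>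
      ⟨by linarith [hy.1, hx.1], hy.2.trans (hmid x hx').1.2⟩
    have hu' : Summable fun n : ℕ => (Nat.casesOn n 0 fun m => ρ * u m) +
        (x / 2)⁻¹ * ((‖A‖ + κ) * u n) := by
      refine Summable.add ?_ ((hu.mul_left _).mul_left _)
      exact (summable_nat_add_iff 1).1 (hu.mul_left ρ)
    have hW := hasDerivAt_tsum_of_isPreconnected (g := w) (g' := w') hu' isOpen_Ioo
      isPreconnected_Ioo (fun n y hy => hderiv n y (hsub y hy)) (fun n y hy => ?_) hxb
      (hsummable x hx') hxb
    · have htsum : ∑' n, w' n x = R x (∑' n, w n x) +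
          x⁻¹ • (A (∑' n, w n x) - κ • ∑' n, w n x) := by
        have hs := (hsummable x hx').hasSum
        refine HasSum.tsum_eq (HasSum.add ?_ (((hs.mapL A).sub (hs.const_smul κ)).const_smul _))
        refine (hasSum_nat_add_iff' 1).1 ?_
        simpa using hs.mapL (R x)
      rw [htsum] at hW
      refine ((Real.hasDerivAt_rpow_const (p := κ) (Or.inl hx.1.ne')).fun_smul hW).congr_deriv ?_
      rw [Real.rpow_sub_one hx.1.ne']
      simp only [map_smul, smul_add, smul_sub]
      module
    · have hy0 : 0 < x / 2 := by linarith [hx.1]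
      have hyb : y ∈ Icc 0 b := ⟨(hsub y hy).1.le, hy.2.le⟩
      refine (norm_add_le _ _).trans (add_le_add ?_ ?_)
      · cases n with
        | zero => simp
        | succ n => exact (R y).le_of_opNorm_le_of_le (hRρ y hyb) (hwu n y hyb)
      · rw [norm_smul, norm_inv, Real.norm_of_nonneg (hsub y hy).1.le]
        refine mul_le_mul (inv_anti₀ hy0 hy.1.le) ?_ (norm_nonneg _) (by positivity)
        refine (norm_sub_le _ _).trans ?_
        rw [add_mul, norm_smul, Real.norm_of_nonneg hκ.le]
        exact add_le_add (A.le_opNorm_of_le (hwu n y hyb))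
          (mul_le_mul_of_nonneg_left (hwu n y hyb) hκ.le)

end Frobenius

/-! ### Solutions that vanish at the origin -/

/-- The part of the coefficient matrix that is regular at the origin. -/
def Residues.regularPart (S : Residues p q) (x : ℝ) : Matrix (Fin 2) (Fin 2) ℝ :=
  ∑ k, (x - S.a k)⁻¹ • S.β k + ∑ l, (2 : ℝ) • (((x : ℂ) - S.c l)⁻¹ • S.γ l).map Complex.re

theorem Residues.B_eq (S : Residues p q) (x : ℝ) : S.B x = x⁻¹ • S.β₁ + S.regularPart x :=
  add_assoc _ _ _

theorem Residues.sub_a_ne_zero {S : Residues p q} {d x : ℝ} (ha : ∀ k, S.a k < 0 ∨ d ≤ S.a k)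
    (hx : x ∈ Ico 0 d) (k : Fin p) : x - S.a k ≠ 0 := by
  rcases ha k with h | h
  · linarith [hx.1]
  · linarith [hx.2]

theorem Residues.sub_c_ne_zero {S : Residues p q} (hc : ∀ l, (S.c l).im ≠ 0) (x : ℝ) (l : Fin q) :
    (x : ℂ) - S.c l ≠ 0 := fun h => hc l (by
  have := congrArg Complex.im h
  simpa using this)

theorem Residues.continuousOn_regularPart {S : Residues p q} {d : ℝ}
    (ha : ∀ k, S.a k < 0 ∨ d ≤ S.a k) (hc : ∀ l, (S.c l).im ≠ 0) :
    ContinuousOn S.regularPart (Ico 0 d) := by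
  refine ContinuousOn.add (continuousOn_finsetSum _ fun k _ => ?_)
    (continuousOn_finsetSum _ fun l _ => ?_)
  · have h : ContinuousOn (fun x : ℝ => (x - S.a k)⁻¹) (Ico 0 d) :=
      ContinuousOn.inv₀ (by fun_prop) fun x hx => sub_a_ne_zero ha hx k
    exact h.smul continuousOn_const
  · refine Continuous.continuousOn (Continuous.const_smul ?_ (2 : ℝ))
    have h : Continuous fun x : ℝ => ((x : ℂ) - S.c l)⁻¹ :=
      (by fun_prop : Continuous fun x : ℝ => (x : ℂ) - S.c l).inv₀ fun x => sub_c_ne_zero hc x l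
    exact (h.smul continuous_const).matrix_map Complex.continuous_re

theorem Residues.trace_B (S : Residues p q) (x : ℝ) : (S.B x).trace = 0 := by
  have h : ∀ l, ((((x : ℂ) - S.c l)⁻¹ • S.γ l).map Complex.re).trace = 0 := fun l => by
    have h1 := congrArg Complex.re
      (show ((((x : ℂ) - S.c l)⁻¹) • S.γ l).trace = 0 by rw [Matrix.trace_smul, S.trace_γ, smul_zero])
    rw [Matrix.trace_fin_two] at h1 ⊢
    exact h1
  simp only [Residues.B, Matrix.trace_add, Matrix.trace_sum, Matrix.trace_smul, S.trace_β₁,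
    S.trace_β, h, smul_zero, Finset.sum_const_zero, add_zero]

/-- Matrices as bounded operators. -/
def mulVecCLM : Matrix (Fin 2) (Fin 2) ℝ →ₗ[ℝ] ((Fin 2 → ℝ) →L[ℝ] (Fin 2 → ℝ)) :=
  LinearMap.toContinuousLinearMap.toLinearMap ∘ₗ (Matrix.toLin' (R := ℝ)).toLinearMap

theorem mulVecCLM_apply (M : Matrix (Fin 2) (Fin 2) ℝ) (v : Fin 2 → ℝ) :
    mulVecCLM M v = M.mulVec v := rfl

theorem continuous_mulVecCLM : Continuous mulVecCLM := LinearMap.continuous_of_finiteDimensional _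

/-- Cayley–Hamilton: a traceless `2 × 2` matrix squares to a scalar, and the eigenvector identifies
that scalar as `κ²`. -/
theorem mulVec_mulVec_of_trace_eq_zero {M : Matrix (Fin 2) (Fin 2) ℝ} (hM : M.trace = 0) {κ : ℝ}
    {v : Fin 2 → ℝ} (hv : v ≠ 0) (h : M.mulVec v = κ • v) (w : Fin 2 → ℝ) :
    M.mulVec (M.mulVec w) = κ ^ 2 • w := by
  rw [Matrix.trace_fin_two] at hM
  have hsq : ∀ w, M.mulVec (M.mulVec w) = (M 0 0 ^ 2 + M 0 1 * M 1 0) • w := fun w => by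
    ext i
    fin_cases i <;> simp [Matrix.mulVec, dotProduct, Fin.sum_univ_two]
    · linear_combination (M 0 1 * w 1) * hM
    · linear_combination (M 1 0 * w 0 + M 1 1 * w 1 - M 0 0 * w 1) * hM
  have h2 : κ ^ 2 • v = (M 0 0 ^ 2 + M 0 1 * M 1 0) • v := by
    rw [← hsq, h, Matrix.mulVec_smul, h, smul_smul, sq]
  rw [hsq, smul_left_injective ℝ hv h2]

/-- This is the Frobenius solution `x^κ W` with `W(0)` an eigenvector of `β₁`. It is nonzero near
`0` because `W(0) ≠ 0`, and the growth bound holds because `W` is bounded on `[0, 1] ⊂ [0, d)`. -/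
theorem Residues.exists_isVanishingSolution {S : Residues p q} {d κ : ℝ} (hd : 1 < d) (hκ : 0 < κ)
    (ha : ∀ k, S.a k < 0 ∨ d ≤ S.a k) (hc : ∀ l, (S.c l).im ≠ 0)
    (hev : Module.End.HasEigenvalue (Matrix.toLin' S.β₁) κ) :
    ∃ Z : ℝ → Fin 2 → ℝ, S.IsVanishingSolution d Z ∧ (∃ x ∈ Ioo 0 d, Z x ≠ 0) ∧
      ∃ C, ∀ x ∈ Ioo (0 : ℝ) 1, ‖Z x‖ ≤ C * x ^ κ := by
  have hd0 : 0 < d := zero_lt_one.trans hd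
  obtain ⟨v, hv⟩ := hev.exists_hasEigenvector
  have hv1 : S.β₁.mulVec v = κ • v := by
    simpa using hv.apply_eq_smul
  obtain ⟨W, hW, hW0, hZ⟩ := exists_frobenius_solution hκ hd0 (A := mulVecCLM S.β₁)
    (mulVec_mulVec_of_trace_eq_zero S.trace_β₁ hv.2 hv1)
    (continuous_mulVecCLM.comp_continuousOn (continuousOn_regularPart ha hc)) hv1
  have hW' : Tendsto W (𝓝[>] 0) (𝓝 v) := by
    have h := hW 0 ⟨le_rfl, hd0⟩
    rw [ContinuousWithinAt, hW0] at h
    rw [← nhdsWithin_Ioo_eq_nhdsGT hd0]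
    exact h.mono_left (nhdsWithin_mono _ Ioo_subset_Ico_self)
  refine ⟨fun x => x ^ κ • W x, ⟨fun x hx => (hZ x hx).congr_deriv ?_, ?_⟩, ?_, ?_⟩
  · rw [S.B_eq, Matrix.add_mulVec, Matrix.smul_mulVec]
    rfl
  · have h : Tendsto (fun x : ℝ => x ^ κ) (𝓝[>] 0) (𝓝 0) := by
      have := (Real.continuousAt_rpow_const 0 κ (Or.inr hκ.le)).tendsto
      rw [Real.zero_rpow hκ.ne'] at this
      exact this.mono_left nhdsWithin_le_nhds
    simpa using h.smul hW'
  · obtain ⟨x, hx, hxd⟩ :=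
      ((hW'.eventually_ne hv.2).and (Ioo_mem_nhdsGT hd0)).exists
    exact ⟨x, hxd, smul_ne_zero (Real.rpow_pos_of_pos hxd.1 _).ne' hx⟩
  · obtain ⟨C, hC⟩ := isCompact_Icc.exists_bound_of_continuousOn
      (hW.mono fun t (ht : t ∈ Icc (0 : ℝ) 1) => ⟨ht.1, ht.2.trans_lt hd⟩)
    refine ⟨C, fun x hx => ?_⟩
    rw [norm_smul, Real.norm_of_nonneg (Real.rpow_nonneg hx.1.le _), mul_comm]
    exact mul_le_mul_of_nonneg_right (hC x (Ioo_subset_Icc_self hx)) (Real.rpow_nonneg hx.1.le _)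

/-- By Liouville's formula the Wronskian is constant when `B` is traceless, and here it tends to `0`
at the origin. -/
theorem Residues.IsVanishingSolution.wronskian_eq_zero {S : Residues p q} {d : ℝ}
    {Z Y : ℝ → Fin 2 → ℝ} (hZ : S.IsVanishingSolution d Z) (hY : S.IsVanishingSolution d Y) :
    ∀ x ∈ Ioo 0 d, Z x 1 * Y x 0 - Z x 0 * Y x 1 = 0 := by
  intro x hx
  have hd : ∀ t ∈ Ioo 0 d, HasDerivAt (fun t => Z t 1 * Y t 0 - Z t 0 * Y t 1) 0 t := fun t ht => by
    have h1 := hasDerivAt_pi.1 (hZ.1 t ht)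
    have h2 := hasDerivAt_pi.1 (hY.1 t ht)
    refine (((h1 1).fun_mul (h2 0)).fun_sub ((h1 0).fun_mul (h2 1))).congr_deriv ?_
    have ht := S.trace_B t
    rw [Matrix.trace_fin_two] at ht
    simp only [Matrix.mulVec, dotProduct, Fin.sum_univ_two]
    linear_combination (Z t 1 * Y t 0 - Z t 0 * Y t 1) * ht
  have hconst : ∀ t ∈ Ioo 0 d, Z t 1 * Y t 0 - Z t 0 * Y t 1 = Z x 1 * Y x 0 - Z x 0 * Y x 1 :=
    fun t ht => isOpen_Ioo.is_const_of_deriv_eq_zero isPreconnected_Ioo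
      (fun y hy => (hd y hy).differentiableAt.differentiableWithinAt)
      (fun y hy => (hd y hy).deriv) ht hx
  have h1 : Tendsto (fun t => Z t 1 * Y t 0 - Z t 0 * Y t 1) (𝓝[>] 0) (𝓝 0) := by
    have h1 := tendsto_pi_nhds.1 hZ.2
    have h2 := tendsto_pi_nhds.1 hY.2
    simpa using ((h1 1).mul (h2 0)).sub ((h1 0).mul (h2 1))
  refine tendsto_nhds_unique (tendsto_const_nhds.congr' ?_) h1
  filter_upwards [Ioo_mem_nhdsGT (hx.1.trans hx.2)] with t ht
  exact (hconst t ht).symm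

/-- The vanishing solutions form a line. -/
theorem Residues.IsVanishingSolution.exists_eq_smul {S : Residues p q} {d : ℝ}
    (ha : ∀ k, S.a k < 0 ∨ d ≤ S.a k) (hc : ∀ l, (S.c l).im ≠ 0)
    {Z Y : ℝ → Fin 2 → ℝ} (hZ : S.IsVanishingSolution d Z) (hY : S.IsVanishingSolution d Y)
    (hY0 : ∃ x ∈ Ioo 0 d, Y x ≠ 0) : ∃ r : ℝ, ∀ x ∈ Ioo 0 d, Z x = r • Y x := by
  obtain ⟨x₀, hx₀, hY0⟩ := hY0
  -- A vanishing Wronskian at `x₀` makes the two vectors parallel there; uniqueness for the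
  -- differential equation propagates the ratio.
  have hr : ∃ r : ℝ, Z x₀ = r • Y x₀ := by
    have hw := hZ.wronskian_eq_zero hY x₀ hx₀
    by_cases h0 : Y x₀ 0 = 0
    · have h1 : Y x₀ 1 ≠ 0 := fun h1 => hY0 (by ext i; fin_cases i <;> assumption)
      refine ⟨Z x₀ 1 / Y x₀ 1, ?_⟩
      ext i
      fin_cases i
      · simp only [Fin.zero_eta, Pi.smul_apply, smul_eq_mul]
        field_simp
        linear_combination -hw
      · simp [h1]
    · refine ⟨Z x₀ 0 / Y x₀ 0, ?_⟩
      ext i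
      fin_cases i
      · simp [h0]
      · simp only [Fin.mk_one, Pi.smul_apply, smul_eq_mul]
        field_simp
        linear_combination hw
  obtain ⟨r, hr⟩ := hr
  refine ⟨r, fun x hx => ?_⟩
  have hmin : 0 < min x x₀ := lt_min hx.1 hx₀.1
  have hmax : max x x₀ < d := max_lt hx.2 hx₀.2
  -- A compact interval inside `(0, d)` whose interior contains `x` and `x₀`; on it `B` is bounded,
  -- which supplies a uniform Lipschitz constant.
  obtain ⟨a, ha0, ham⟩ := exists_between hmin
  obtain ⟨b, hbm, hbd⟩ := exists_between hmax
  have hsub : ∀ t ∈ Icc a b, t ∈ Ioo 0 d := fun t ht => ⟨ha0.trans_le ht.1, ht.2.trans_lt hbd⟩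
  have hB : ContinuousOn (fun t => mulVecCLM (S.B t)) (Icc a b) := by
    refine continuous_mulVecCLM.comp_continuousOn ?_
    rw [show S.B = fun t => t⁻¹ • S.β₁ + S.regularPart t from funext S.B_eq]
    exact ((continuousOn_inv₀.mono fun t ht => (hsub t ht).1.ne').smul continuousOn_const).add
      ((continuousOn_regularPart ha hc).mono fun t ht => Ioo_subset_Ico_self (hsub t ht))
  obtain ⟨K, hK⟩ := isCompact_Icc.exists_bound_of_continuousOn hB
  refine ODE_solution_unique_of_mem_Ioo (v := fun t => mulVecCLM (S.B t)) (s := fun _ => univ)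
    (K := K.toNNReal) (a := a) (b := b) (t₀ := x₀) (f := Z) (g := fun x => r • Y x)
    (fun t ht => ?_) ⟨ham.trans_le (min_le_right _ _), (le_max_right _ _).trans_lt hbm⟩
    (fun t ht => ⟨hZ.1 t (hsub t (Ioo_subset_Icc_self ht)), mem_univ _⟩)
    (fun t ht => ⟨?_, mem_univ _⟩) hr
    ⟨ham.trans_le (min_le_left _ _), (le_max_left _ _).trans_lt hbm⟩
  · refine ((mulVecCLM (S.B t)).lipschitz.weaken ?_).lipschitzOnWith
    rw [← norm_toNNReal]
    exact Real.toNNReal_le_toNNReal (hK t (Ioo_subset_Icc_self ht))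
  · refine ((hY.1 t (hsub t (Ioo_subset_Icc_self ht))).const_smul r).congr_deriv ?_
    rw [mulVecCLM_apply, Matrix.mulVec_smul]

/-- Mere convergence to `0` upgrades to the rate `x^κ`, since the solution is a multiple of the
Frobenius one. -/
theorem Residues.IsVanishingSolution.exists_norm_le {S : Residues p q} {d κ : ℝ} (hd : 1 < d)
    (hκ : 0 < κ) (ha : ∀ k, S.a k < 0 ∨ d ≤ S.a k) (hc : ∀ l, (S.c l).im ≠ 0)
    (hev : Module.End.HasEigenvalue (Matrix.toLin' S.β₁) κ) {Z : ℝ → Fin 2 → ℝ}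
    (hZ : S.IsVanishingSolution d Z) : ∃ C, 0 ≤ C ∧ ∀ x ∈ Ioo (0 : ℝ) 1, ‖Z x‖ ≤ C * x ^ κ := by
  obtain ⟨Y, hY, hY0, C, hC⟩ := exists_isVanishingSolution hd hκ ha hc hev
  obtain ⟨r, hr⟩ := hZ.exists_eq_smul ha hc hY hY0
  refine ⟨|r| * |C|, by positivity, fun x hx => ?_⟩
  rw [hr x ⟨hx.1, hx.2.trans hd⟩, norm_smul, Real.norm_eq_abs, mul_assoc]
  refine mul_le_mul_of_nonneg_left ((hC x hx).trans ?_) (abs_nonneg r)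
  exact mul_le_mul_of_nonneg_right (le_abs_self C) (Real.rpow_nonneg hx.1.le _)

/-! ### The symbol of the Hankel operator -/

/-- The real coordinates of `s r v` for real `s, v` and complex `r`. -/
def complexCoords (s : ℝ) (r : ℂ) (v : Fin 2 → ℝ) : Fin 2 ⊕ Fin 2 → ℝ :=
  Sum.elim (fun i => s * r.re * v i) (fun i => s * r.im * v i)

/-- The symbol at `x` as a linear function of the value `v` of the solution at `x`, for given
congruences `P`, `Q` between the forms at the poles and the signature blocks. -/
def Residues.symbolVec (S : Residues p q) (P : Fin p → Matrix (Fin 2) (Fin 2) ℝ)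
    (Q : Fin q → Matrix (Fin 2 ⊕ Fin 2) (Fin 2 ⊕ Fin 2) ℝ) (x : ℝ) (v : Fin 2 → ℝ) :
    EuclideanSpace ℝ (VecIdx p q) :=
  WithLp.toLp 2 fun j => Sum.elim
    (fun k => (P k).mulVec ((√x * (x - S.a k)⁻¹) • v) j.1)
    (fun l => (Q l.1).mulVec (complexCoords (√x) ((x : ℂ) - S.c l.1)⁻¹ v)
      (if l.2 = 0 then Sum.inl j.1 else Sum.inr j.1)) j.2

/-- Linearity in `v` reduces continuity and bounds of the symbol to two fixed vectors, independent
of the solution. -/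
theorem Residues.symbolVec_eq (S : Residues p q) (P : Fin p → Matrix (Fin 2) (Fin 2) ℝ)
    (Q : Fin q → Matrix (Fin 2 ⊕ Fin 2) (Fin 2 ⊕ Fin 2) ℝ) (x : ℝ) (v : Fin 2 → ℝ) :
    S.symbolVec P Q x v =
      v 0 • S.symbolVec P Q x ![1, 0] + v 1 • S.symbolVec P Q x ![0, 1] := by
  ext ⟨i, k | ⟨l, e⟩⟩
  · simp [Residues.symbolVec, Matrix.mulVec, dotProduct, Fin.sum_univ_two]
    ring
  · simp [Residues.symbolVec, complexCoords, Matrix.mulVec, dotProduct, Fin.sum_univ_two]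
    ring

theorem Residues.continuousOn_symbolVec {S : Residues p q} {d : ℝ}
    (ha : ∀ k, S.a k < 0 ∨ d ≤ S.a k) (hc : ∀ l, (S.c l).im ≠ 0)
    (P : Fin p → Matrix (Fin 2) (Fin 2) ℝ)
    (Q : Fin q → Matrix (Fin 2 ⊕ Fin 2) (Fin 2 ⊕ Fin 2) ℝ) (v : Fin 2 → ℝ) :
    ContinuousOn (fun x => S.symbolVec P Q x v) (Ico 0 d) := by
  refine (PiLp.continuous_toLp 2 _).comp_continuousOn (continuousOn_pi.2 ?_)
  rintro ⟨i, k | ⟨l, e⟩⟩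
  · have h : ContinuousOn (fun x : ℝ => (x - S.a k)⁻¹) (Ico 0 d) :=
      ContinuousOn.inv₀ (by fun_prop) fun x hx => sub_a_ne_zero ha hx k
    simp only [Sum.elim_inl, Matrix.mulVec, dotProduct, Fin.sum_univ_two, Pi.smul_apply,
      smul_eq_mul]
    fun_prop
  · have h : Continuous fun x : ℝ => ((x : ℂ) - S.c l)⁻¹ :=
      (by fun_prop : Continuous fun x : ℝ => (x : ℂ) - S.c l).inv₀ fun x => sub_c_ne_zero hc x l
    have h1 : Continuous fun x : ℝ => (((x : ℂ) - S.c l)⁻¹).re := Complex.continuous_re.comp h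
    have h2 : Continuous fun x : ℝ => (((x : ℂ) - S.c l)⁻¹).im := Complex.continuous_im.comp h
    refine Continuous.continuousOn ?_
    simp only [Sum.elim_inr, complexCoords, Matrix.mulVec, dotProduct, Fintype.sum_sum_type,
      Fin.sum_univ_two, Sum.elim_inl]
    fun_prop

theorem Residues.norm_symbolVec_le {S : Residues p q} {d : ℝ} (hd : 1 < d)
    (ha : ∀ k, S.a k < 0 ∨ d ≤ S.a k) (hc : ∀ l, (S.c l).im ≠ 0)
    (P : Fin p → Matrix (Fin 2) (Fin 2) ℝ)
    (Q : Fin q → Matrix (Fin 2 ⊕ Fin 2) (Fin 2 ⊕ Fin 2) ℝ) :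
    ∃ C, 0 ≤ C ∧ ∀ x ∈ Ioo (0 : ℝ) 1, ∀ v, ‖S.symbolVec P Q x v‖ ≤ C * ‖v‖ := by
  have hb : ∀ v, ∃ C, ∀ x ∈ Icc (0 : ℝ) 1, ‖S.symbolVec P Q x v‖ ≤ C := fun v =>
    isCompact_Icc.exists_bound_of_continuousOn ((continuousOn_symbolVec ha hc P Q v).mono
      fun t ht => ⟨ht.1, ht.2.trans_lt hd⟩)
  obtain ⟨C₀, h₀⟩ := hb ![1, 0]
  obtain ⟨C₁, h₁⟩ := hb ![0, 1]
  have hC₀ : 0 ≤ C₀ := (norm_nonneg _).trans (h₀ 0 (by simp))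
  have hC₁ : 0 ≤ C₁ := (norm_nonneg _).trans (h₁ 0 (by simp))
  refine ⟨C₀ + C₁, by positivity, fun x hx v => ?_⟩
  have hx' := Ioo_subset_Icc_self hx
  rw [S.symbolVec_eq, add_mul]
  refine (norm_add_le _ _).trans (add_le_add ?_ ?_)
  · rw [norm_smul, mul_comm]
    exact mul_le_mul (h₀ x hx') (norm_le_pi_norm v 0) (norm_nonneg _) hC₀
  · rw [norm_smul, mul_comm]
    exact mul_le_mul (h₁ x hx') (norm_le_pi_norm v 1) (norm_nonneg _) hC₁

/-- The symbol `ψ`. -/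
def Residues.symbol (S : Residues p q) (P : Fin p → Matrix (Fin 2) (Fin 2) ℝ)
    (Q : Fin q → Matrix (Fin 2 ⊕ Fin 2) (Fin 2 ⊕ Fin 2) ℝ) (Z : ℝ → Fin 2 → ℝ) :
    ℝ → EuclideanSpace ℝ (VecIdx p q) :=
  (Ioo 0 1).indicator fun x => S.symbolVec P Q x (Z x)

theorem Residues.symbol_of_mem (S : Residues p q) (P : Fin p → Matrix (Fin 2) (Fin 2) ℝ)
    (Q : Fin q → Matrix (Fin 2 ⊕ Fin 2) (Fin 2 ⊕ Fin 2) ℝ) (Z : ℝ → Fin 2 → ℝ) {x : ℝ}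
    (hx : x ∈ Ioo (0 : ℝ) 1) : S.symbol P Q Z x = S.symbolVec P Q x (Z x) :=
  indicator_of_mem hx _

theorem Residues.IsVanishingSolution.continuousOn {S : Residues p q} {d : ℝ} {Z : ℝ → Fin 2 → ℝ}
    (hZ : S.IsVanishingSolution d Z) : ContinuousOn Z (Ioo 0 d) :=
  fun x hx => (hZ.1 x hx).continuousAt.continuousWithinAt

theorem Residues.IsVanishingSolution.continuousOn_symbol {S : Residues p q} {d : ℝ} (hd : 1 < d)
    (ha : ∀ k, S.a k < 0 ∨ d ≤ S.a k) (hc : ∀ l, (S.c l).im ≠ 0) {Z : ℝ → Fin 2 → ℝ}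
    (hZ : S.IsVanishingSolution d Z) (P : Fin p → Matrix (Fin 2) (Fin 2) ℝ)
    (Q : Fin q → Matrix (Fin 2 ⊕ Fin 2) (Fin 2 ⊕ Fin 2) ℝ) :
    ContinuousOn (S.symbol P Q Z) (Ioo 0 1) := by
  have hsub : Ioo (0 : ℝ) 1 ⊆ Ico 0 d := fun t ht => ⟨ht.1.le, ht.2.trans hd⟩
  have hZc := continuousOn_pi.1 (hZ.continuousOn.mono (Ioo_subset_Ioo_right hd.le))
  have h : ∀ v, ContinuousOn (fun x => S.symbolVec P Q x v) (Ioo 0 1) := fun v =>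
    (continuousOn_symbolVec ha hc P Q v).mono hsub
  refine (((hZc 0).smul (h ![1, 0])).add ((hZc 1).smul (h ![0, 1]))).congr fun x hx => ?_
  rw [S.symbol_of_mem P Q Z hx, S.symbolVec_eq]
  rfl

theorem Residues.IsVanishingSolution.measurable_symbol {S : Residues p q} {d : ℝ} (hd : 1 < d)
    (ha : ∀ k, S.a k < 0 ∨ d ≤ S.a k) (hc : ∀ l, (S.c l).im ≠ 0) {Z : ℝ → Fin 2 → ℝ}
    (hZ : S.IsVanishingSolution d Z) (P : Fin p → Matrix (Fin 2) (Fin 2) ℝ)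
    (Q : Fin q → Matrix (Fin 2 ⊕ Fin 2) (Fin 2 ⊕ Fin 2) ℝ) : Measurable (S.symbol P Q Z) := by
  have h := (hZ.continuousOn_symbol hd ha hc P Q).measurable_piecewise
    (continuousOn_const (c := (0 : EuclideanSpace ℝ (VecIdx p q)))) measurableSet_Ioo
  convert h using 1
  ext1 x
  by_cases hx : x ∈ Ioo (0 : ℝ) 1
  · rw [piecewise_eq_of_mem _ _ _ hx]
  · rw [piecewise_eq_of_notMem _ _ _ hx, Residues.symbol, indicator_of_notMem hx]

/-! ### The Hankel factorization of the kernel -/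

theorem dotProduct_sigma_mulVec (s : PoleIdx p q → Matrix (Fin 2) (Fin 2) ℝ)
    (u v : VecIdx p q → ℝ) : dotProduct u ((sigma s).mulVec v) =
      ∑ k, dotProduct (fun i => u (i, k)) ((s k).mulVec fun i => v (i, k)) := by
  simp only [sigma, dotProduct, Matrix.mulVec, Fintype.sum_prod_type_right,
    Matrix.blockDiagonal_apply, ite_mul, zero_mul]
  refine Finset.sum_congr rfl fun k _ => Finset.sum_congr rfl fun i _ => ?_
  rw [Finset.sum_comm]
  simp

theorem dotProduct_congruence {n : Type*} [Fintype n] (P s M : Matrix n n ℝ)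
    (h : P.transpose * s * P = M) (u v : n → ℝ) :
    dotProduct (P.mulVec u) (s.mulVec (P.mulVec v)) = dotProduct u (M.mulVec v) := by
  rw [← h, ← Matrix.mulVec_mulVec, ← Matrix.mulVec_mulVec, Matrix.dotProduct_mulVec u P.transpose,
    Matrix.vecMul_transpose]

theorem dotProduct_fromBlocks (A B : Matrix (Fin 2) (Fin 2) ℝ) (u v : Fin 2 ⊕ Fin 2 → ℝ) :
    dotProduct u ((Matrix.fromBlocks A 0 0 B).mulVec v) =
      dotProduct (fun i => u (Sum.inl i)) (A.mulVec fun i => v (Sum.inl i)) +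
      dotProduct (fun i => u (Sum.inr i)) (B.mulVec fun i => v (Sum.inr i)) := by
  simp [dotProduct, Matrix.mulVec, Fin.sum_univ_two]

/-- The block matrix is that of the bilinear form `2 Re(wᵀ M w')`, evaluated at `w = s r u` and `w'
= s' r' v`. -/
theorem dotProduct_complexCoords (M : Matrix (Fin 2) (Fin 2) ℂ) (s s' : ℝ) (r r' : ℂ)
    (u v : Fin 2 → ℝ) :
    dotProduct (complexCoords s r u) (((2 : ℝ) • Matrix.fromBlocks
      (M.map Complex.re) (-M.map Complex.im) (-M.map Complex.im) (-M.map Complex.re)).mulVec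
        (complexCoords s' r' v)) =
      s * s' * dotProduct u (((2 : ℝ) • ((r * r') • M).map Complex.re).mulVec v) := by
  simp [complexCoords, dotProduct, Matrix.mulVec, Fin.sum_univ_two]
  ring

/-- Multiplication by `x` turns the term `β₁/x` into a constant, so it drops out of the difference;
hence `σ` involves only the poles other than `0`. -/
theorem Residues.smul_B_sub_smul_B (S : Residues p q) {x y : ℝ} (hx : x ≠ 0) (hy : y ≠ 0) :
    y • S.B y - x • S.B x = ∑ k, (y * (y - S.a k)⁻¹ - x * (x - S.a k)⁻¹) • S.β k +
      ∑ l, (2 : ℝ) • (((y : ℂ) * ((y : ℂ) - S.c l)⁻¹ - (x : ℂ) * ((x : ℂ) - S.c l)⁻¹) •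
        S.γ l).map Complex.re := by
  simp only [Residues.B, smul_add, Finset.smul_sum, smul_smul, mul_inv_cancel₀ hx,
    mul_inv_cancel₀ hy]
  rw [add_sub_add_comm, add_sub_add_comm, sub_self, zero_add, ← Finset.sum_sub_distrib,
    ← Finset.sum_sub_distrib]
  congr 1
  · exact Finset.sum_congr rfl fun k _ => (sub_smul _ _ _).symm
  · refine Finset.sum_congr rfl fun l _ => ?_
    ext i j
    simp
    ring

/-- The two congruences that relate a signature to the forms at the poles. -/
structure Residues.IsCongruence (S : Residues p q) (s : PoleIdx p q → Matrix (Fin 2) (Fin 2) ℝ)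
    (P : Fin p → Matrix (Fin 2) (Fin 2) ℝ)
    (Q : Fin q → Matrix (Fin 2 ⊕ Fin 2) (Fin 2 ⊕ Fin 2) ℝ) : Prop where
  real : ∀ k, (P k).transpose * s (Sum.inl k) * P k = S.realForm k
  pair : ∀ l, (Q l).transpose * Matrix.fromBlocks (s (Sum.inr (l, 0))) 0 0 (s (Sum.inr (l, 1))) *
    Q l = S.pairForm l

theorem Residues.IsSignature.exists_isCongruence {S : Residues p q}
    {s : PoleIdx p q → Matrix (Fin 2) (Fin 2) ℝ} (hs : S.IsSignature s) :
    ∃ P Q, S.IsCongruence s P Q := by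
  choose P _ hP using hs.2.1
  choose Q _ hQ using hs.2.2
  exact ⟨P, Q, hP, hQ⟩

theorem Residues.IsCongruence.dotProduct_symbolVec {S : Residues p q}
    {s : PoleIdx p q → Matrix (Fin 2) (Fin 2) ℝ} {P : Fin p → Matrix (Fin 2) (Fin 2) ℝ}
    {Q : Fin q → Matrix (Fin 2 ⊕ Fin 2) (Fin 2 ⊕ Fin 2) ℝ} (h : S.IsCongruence s P Q) (x y : ℝ)
    (u v : Fin 2 → ℝ) :
    dotProduct (S.symbolVec P Q x u).ofLp ((sigma s).mulVec (S.symbolVec P Q y v).ofLp) =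
      √x * √y * (∑ k, dotProduct u ((((x - S.a k)⁻¹ * (y - S.a k)⁻¹) • S.realForm k).mulVec v) +
        ∑ l, dotProduct u (((2 : ℝ) • ((((x : ℂ) - S.c l)⁻¹ * ((y : ℂ) - S.c l)⁻¹) •
          S.complexForm l).map Complex.re).mulVec v)) := by
  rw [dotProduct_sigma_mulVec, Fintype.sum_sum_type, Fintype.sum_prod_type, mul_add,
    Finset.mul_sum, Finset.mul_sum]
  congr 1
  · refine Finset.sum_congr rfl fun k _ => ?_
    simp only [Residues.symbolVec, Sum.elim_inl]
    refine (dotProduct_congruence _ _ _ (h.real k) _ _).trans ?_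
    simp only [Matrix.mulVec_smul, Matrix.smul_mulVec, smul_dotProduct, dotProduct_smul,
      smul_eq_mul]
    ring
  · refine Finset.sum_congr rfl fun l _ => ?_
    rw [Fin.sum_univ_two]
    simp only [Residues.symbolVec, Sum.elim_inr, one_ne_zero, if_true, if_false]
    refine (dotProduct_fromBlocks _ _ _ _).symm.trans ?_
    refine (dotProduct_congruence _ _ _ (h.pair l) _ _).trans ?_
    exact dotProduct_complexCoords _ _ _ _ _ _ _

/-- The algebraic core: the difference quotient of `x/(x-δ)` separates as `-δ/((x-δ)(y-δ))`, and the
numerator combines with `J β` into the form diagonalized by `σ`. -/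
theorem Residues.IsCongruence.sub_mul_dotProduct_symbolVec {S : Residues p q} {d : ℝ}
    (ha : ∀ k, S.a k < 0 ∨ d ≤ S.a k) (hc : ∀ l, (S.c l).im ≠ 0)
    {s : PoleIdx p q → Matrix (Fin 2) (Fin 2) ℝ} {P : Fin p → Matrix (Fin 2) (Fin 2) ℝ}
    {Q : Fin q → Matrix (Fin 2 ⊕ Fin 2) (Fin 2 ⊕ Fin 2) ℝ} (h : S.IsCongruence s P Q) {x y : ℝ}
    (hx : x ∈ Ioo 0 d) (hy : y ∈ Ioo 0 d) (u v : Fin 2 → ℝ) :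
    (y - x) * dotProduct (S.symbolVec P Q x u).ofLp
        ((sigma s).mulVec (S.symbolVec P Q y v).ofLp) =
      √x * √y * dotProduct u (J.mulVec ((y • S.B y - x • S.B x).mulVec v)) := by
  rw [h.dotProduct_symbolVec, S.smul_B_sub_smul_B hx.1.ne' hy.1.ne', mul_left_comm]
  congr 1
  simp only [Matrix.add_mulVec, Matrix.sum_mulVec, Matrix.mulVec_add, Matrix.mulVec_sum,
    dotProduct_add, dotProduct_sum, mul_add, Finset.mul_sum]
  congr 1
  · refine Finset.sum_congr rfl fun k _ => ?_
    have hx0 := sub_a_ne_zero ha (Ioo_subset_Ico_self hx) k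
    have hy0 := sub_a_ne_zero ha (Ioo_subset_Ico_self hy) k
    have hr : y * (y - S.a k)⁻¹ - x * (x - S.a k)⁻¹ =
        (y - x) * ((x - S.a k)⁻¹ * (y - S.a k)⁻¹ * -S.a k) := by
      field_simp
      ring
    rw [hr, Residues.realForm, smul_smul, Matrix.smul_mulVec, Matrix.smul_mulVec,
      Matrix.mulVec_smul, Matrix.mulVec_mulVec, dotProduct_smul, dotProduct_smul, smul_eq_mul,
      smul_eq_mul]
    ring
  · refine Finset.sum_congr rfl fun l _ => ?_
    have hx0 := sub_c_ne_zero hc x l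
    have hy0 := sub_c_ne_zero hc y l
    have hr : (y : ℂ) * ((y : ℂ) - S.c l)⁻¹ - (x : ℂ) * ((x : ℂ) - S.c l)⁻¹ =
        ((y - x : ℝ) : ℂ) * (((x : ℂ) - S.c l)⁻¹ * ((y : ℂ) - S.c l)⁻¹ * -S.c l) := by
      push_cast
      field_simp
      ring
    rw [hr, Residues.complexForm, smul_smul, Matrix.mulVec_mulVec]
    generalize ((x : ℂ) - S.c l)⁻¹ * ((y : ℂ) - S.c l)⁻¹ * -S.c l = r
    simp [J, dotProduct, Matrix.mulVec, Matrix.mul_apply, Fin.sum_univ_two]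
    ring

/-- The derivative falling on the left factor is moved to the right one by `Bᵀ J = -J B`, which is
vanishing of the trace. -/
theorem Residues.IsVanishingSolution.hasDerivAt_pairing {S : Residues p q} {d : ℝ}
    {Z : ℝ → Fin 2 → ℝ} (hZ : S.IsVanishingSolution d Z) {z ζ t : ℝ} (ht : t ≠ 0)
    (hz : t * z ∈ Ioo 0 d) (hζ : t * ζ ∈ Ioo 0 d) :
    HasDerivAt (fun t => dotProduct (Z (t * z)) (J.mulVec (Z (t * ζ))))
      (t⁻¹ * dotProduct (Z (t * z)) (J.mulVec
        (((t * ζ) • S.B (t * ζ) - (t * z) • S.B (t * z)).mulVec (Z (t * ζ))))) t := by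
  have hd : ∀ w, t * w ∈ Ioo 0 d → ∀ i, HasDerivAt (fun t => Z (t * w) i)
      (w * (S.B (t * w)).mulVec (Z (t * w)) i) t := fun w hw i => by
    have h1 := hasDerivAt_pi.1 (hZ.1 _ hw) i
    have h2 : HasDerivAt (fun t => t * w) w t := by simpa using (hasDerivAt_id t).mul_const w
    exact (h1.comp t h2).congr_deriv (mul_comm _ _)
  have h1 := ((hd z hz 1).fun_mul (hd ζ hζ 0)).fun_sub ((hd z hz 0).fun_mul (hd ζ hζ 1))
  have hfun : (fun t => dotProduct (Z (t * z)) (J.mulVec (Z (t * ζ)))) =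
      fun t => Z (t * z) 1 * Z (t * ζ) 0 - Z (t * z) 0 * Z (t * ζ) 1 := by
    ext t
    simp [J, dotProduct, Matrix.mulVec, Fin.sum_univ_two]
    ring
  rw [hfun]
  refine h1.congr_deriv ?_
  have htr := S.trace_B (t * z)
  rw [Matrix.trace_fin_two] at htr
  rw [eq_inv_mul_iff_mul_eq₀ ht]
  simp [J, dotProduct, Matrix.mulVec, Fin.sum_univ_two]
  linear_combination t * z * (Z (t * z) 1 * Z (t * ζ) 0 - Z (t * z) 0 * Z (t * ζ) 1) * htr

/-! ### The measure `dx / x` -/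

instance sigmaFinite_μ : SigmaFinite μ := SigmaFinite.withDensity_ofReal _

theorem ae_mem_Ioo : ∀ᵐ x ∂μ, x ∈ Ioo (0 : ℝ) 1 :=
  (withDensity_absolutelyContinuous _ _).ae_le (ae_restrict_mem measurableSet_Ioo)

theorem ae_ne (z : ℝ) : ∀ᵐ x ∂μ, x ≠ z :=
  (withDensity_absolutelyContinuous _ _).ae_le (compl_mem_ae_iff.2 (measure_singleton z))

theorem integrable_μ_iff {f : ℝ → ℝ} :
    Integrable f μ ↔ IntegrableOn (fun x => x⁻¹ * f x) (Ioo 0 1) := by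
  rw [μ, integrable_withDensity_iff_integrable_smul' (by fun_prop) (by simp), IntegrableOn]
  refine integrable_congr ?_
  filter_upwards [ae_restrict_mem measurableSet_Ioo] with x hx
  rw [ENNReal.toReal_ofReal (inv_nonneg.2 hx.1.le), smul_eq_mul]

theorem integral_μ (f : ℝ → ℝ) : ∫ x, f x ∂μ = ∫ x in (0 : ℝ)..1, x⁻¹ * f x := by
  rw [μ, integral_withDensity_eq_integral_toReal_smul (by fun_prop) (by simp),
    intervalIntegral.integral_of_le zero_le_one, integral_Ioc_eq_integral_Ioo]
  refine setIntegral_congr_fun measurableSet_Ioo fun x hx => ?_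
  simp only [ENNReal.toReal_ofReal (inv_nonneg.2 hx.1.le), smul_eq_mul]

/-- The square has integral `∫ x^(2κ-1) dx`, finite since `κ > 0`. Using `|x|` gives a nonnegative
majorant on all of `ℝ`, as dominated kernels require. -/
theorem memLp_rpow {κ : ℝ} (hκ : 0 < κ) (C : ℝ) : MemLp (fun x : ℝ => C * |x| ^ κ) 2 μ := by
  rw [memLp_two_iff_integrable_sq (by fun_prop (disch := exact hκ.le)), integrable_μ_iff]
  have h : IntegrableOn (fun x : ℝ => C ^ 2 * x ^ (2 * κ - 1)) (Ioo 0 1) := by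
    rw [← intervalIntegrable_iff_integrableOn_Ioo_of_le zero_le_one]
    exact (intervalIntegral.intervalIntegrable_rpow' (by linarith)).const_mul _
  refine h.congr_fun (fun x hx => ?_) measurableSet_Ioo
  simp only [abs_of_pos hx.1]
  rw [Real.rpow_sub_one hx.1.ne', two_mul, Real.rpow_add hx.1]
  ring

/-! ### The Hankel operator of the symbol and the kernel of `Γ† σ Γ` -/

theorem Residues.IsVanishingSolution.exists_isDominatedKernel {S : Residues p q} {d κ : ℝ}
    (hd : 1 < d) (hκ : 0 < κ) (ha : ∀ k, S.a k < 0 ∨ d ≤ S.a k) (hc : ∀ l, (S.c l).im ≠ 0)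
    (hev : Module.End.HasEigenvalue (Matrix.toLin' S.β₁) κ) {Z : ℝ → Fin 2 → ℝ}
    (hZ : S.IsVanishingSolution d Z) (P : Fin p → Matrix (Fin 2) (Fin 2) ℝ)
    (Q : Fin q → Matrix (Fin 2 ⊕ Fin 2) (Fin 2 ⊕ Fin 2) ℝ) :
    ∃ g, IsDominatedKernel μ (vectorKernel fun x y => S.symbol P Q Z (x * y)) g := by
  obtain ⟨C, hC, hCb⟩ := norm_symbolVec_le hd ha hc P Q
  obtain ⟨C', hC', hCb'⟩ := hZ.exists_norm_le hd hκ ha hc hev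
  have hb : ∀ x, ‖S.symbol P Q Z x‖ ≤ C * C' * |x| ^ κ := fun x => by
    by_cases hx : x ∈ Ioo (0 : ℝ) 1
    · rw [S.symbol_of_mem P Q Z hx, abs_of_pos hx.1, mul_assoc]
      exact (hCb x hx _).trans (mul_le_mul_of_nonneg_left (hCb' x hx) hC)
    · rw [Residues.symbol, indicator_of_notMem hx, norm_zero]
      positivity
  -- Multiplicativity of `|x|^κ` splits the bound on `ψ(xy)` into a product, the constant being
  -- shared as two square roots.
  refine ⟨fun x => √(C * C') * |x| ^ κ, isDominatedKernel_vectorKernel ?_ (memLp_rpow hκ _)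
    (fun x => by positivity) fun x y => (hb _).trans_eq ?_⟩
  · exact ((hZ.measurable_symbol hd ha hc P Q).comp measurable_mul).stronglyMeasurable
  · rw [abs_mul, Real.mul_rpow (abs_nonneg _) (abs_nonneg _), mul_mul_mul_comm (√(C * C')),
      Real.mul_self_sqrt (by positivity)]

/-- The kernel of `Γ† σ Γ` for a Hankel operator `Γ`. -/
theorem isIntegralOperator_adjoint_comp {ψ : ℝ → EuclideanSpace ℝ (VecIdx p q)} {g : ℝ → ℝ}
    (hk : IsDominatedKernel μ (vectorKernel fun x y => ψ (x * y)) g)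
    (σ : Matrix (VecIdx p q) (VecIdx p q) ℝ) {k : ℝ → ℝ → ℝ}
    (hkψ : ∀ z ∈ Ioo (0 : ℝ) 1, ∀ ζ ∈ Ioo (0 : ℝ) 1, z ≠ ζ → k z ζ =
      ∫ x, inner ℝ (ψ (x * z)) (Matrix.toEuclideanCLM (n := VecIdx p q) (𝕜 := ℝ) σ (ψ (x * ζ))) ∂μ) :
    IsIntegralOperator (ContinuousLinearMap.adjoint hk.operator ∘L matrixOp σ ∘L hk.operator) k := by
  intro f
  set T := Matrix.toEuclideanCLM (n := VecIdx p q) (𝕜 := ℝ) σ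
  filter_upwards [hk.coeFn_adjoint_operator (matrixOp σ (hk.operator f)), ae_mem_Ioo] with z hz hz01
  -- The formula for `k` is only assumed off the diagonal, which is null for each `z`. The kernel of
  -- the theorem is divided by `0` on the diagonal.
  have hk' : ∀ᵐ ζ ∂μ, k z ζ * f ζ = ∫ x, f ζ * inner ℝ (ψ (x * z)) (T (ψ (x * ζ))) ∂μ := by
    filter_upwards [ae_mem_Ioo, ae_ne z] with ζ hζ hne
    rw [hkψ z hz01 ζ hζ hne.symm, integral_const_mul, mul_comm]
  have hint : Integrable (fun w : ℝ × ℝ => f w.2 * inner ℝ (ψ (w.1 * z)) (T (ψ (w.1 * w.2))))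
      (μ.prod μ) := by
    refine ((hk.memLp.integrable_sq.const_mul (g z * ‖T‖)).mul_prod
      (integrable_mul_norm_Lp hk.memLp f)).mono' ?_ (ae_of_all _ fun w => ?_)
    · have h1 := hk.stronglyMeasurable_vector
      have h2 : StronglyMeasurable fun w : ℝ × ℝ => ψ (w.1 * z) :=
        h1.comp_measurable (g := fun w : ℝ × ℝ => (w.1, z)) (by fun_prop)
      exact (Lp.aestronglyMeasurable f).comp_snd.mul
        (h2.inner (T.continuous.comp_stronglyMeasurable h1)).aestronglyMeasurable
    · have hw : 0 ≤ g w.1 * g z := mul_nonneg (hk.nonneg _) (hk.nonneg _)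
      rw [norm_mul]
      have h1 : ‖inner ℝ (ψ (w.1 * z)) (T (ψ (w.1 * w.2)))‖ ≤
          (g w.1 * g z) * (‖T‖ * (g w.1 * g w.2)) :=
        (norm_inner_le_norm _ _).trans (mul_le_mul (hk.norm_vector_le _ _)
          (T.le_opNorm_of_le (hk.norm_vector_le _ _)) (norm_nonneg _) hw)
      refine (mul_le_mul_of_nonneg_left h1 (norm_nonneg _)).trans_eq ?_
      ring
  refine ⟨hint.integral_prod_right.congr (hk'.mono fun ζ h => h.symm), ?_⟩
  rw [ContinuousLinearMap.comp_apply, ContinuousLinearMap.comp_apply, hz, integral_congr_ae hk']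
  refine Eq.trans ?_ (integral_integral_swap hint)
  refine integral_congr_ae ?_
  filter_upwards [ContinuousLinearMap.coeFn_compLpL (p := 2) (μ := μ) T (hk.operator f),
    hk.coeFn_operator f] with x h1 h2
  rw [matrixOp, h1, h2, ← T.integral_comp_comm (hk.integrable f x),
    ← integral_inner (T.integrable_comp (hk.integrable f x))]
  refine integral_congr_ae (ae_of_all _ fun ζ => ?_)
  simp only [ContinuousLinearMap.toSpanSingleton_apply, map_smul, inner_smul_right]

theorem isTraceClass_adjoint_operator_comp {ψ : ℝ → ℝ → EuclideanSpace ℝ (VecIdx p q)}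
    {g : ℝ → ℝ} (hk : IsDominatedKernel μ (vectorKernel ψ) g) (M : Vector p q →L[ℝ] Vector p q) :
    IsTraceClass (ContinuousLinearMap.adjoint hk.operator ∘L M ∘L hk.operator) :=
  isTraceClass_adjoint_comp _ _ fun M' => ⟨_, fun _ he s => hk.sum_norm_adjoint_sq_le M' he s⟩

theorem IsIntegralOperator.unique {T T' : Scalar →L[ℝ] Scalar} {k : ℝ → ℝ → ℝ}
    (h : IsIntegralOperator T k) (h' : IsIntegralOperator T' k) : T = T' := by
  ext1 f
  refine Lp.ext ?_
  filter_upwards [h f, h' f] with x hx hx'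
  rw [hx.2, hx'.2]

/-- The fundamental theorem of calculus for `F(t)`, a multiple of `Z(tz)ᵀ J Z(tζ)`, on `(0, 1)`: `F`
tends to `0` at the origin and `F(1)` is the kernel, by antisymmetry of `J`. -/
theorem Residues.IsVanishingSolution.kernel_eq {S : Residues p q} {d : ℝ} (hd : 1 < d)
    (ha : ∀ k, S.a k < 0 ∨ d ≤ S.a k) (hc : ∀ l, (S.c l).im ≠ 0) {Z : ℝ → Fin 2 → ℝ}
    (hZ : S.IsVanishingSolution d Z) {s : PoleIdx p q → Matrix (Fin 2) (Fin 2) ℝ}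
    {P : Fin p → Matrix (Fin 2) (Fin 2) ℝ} {Q : Fin q → Matrix (Fin 2 ⊕ Fin 2) (Fin 2 ⊕ Fin 2) ℝ}
    (h : S.IsCongruence s P Q) {g : ℝ → ℝ}
    (hk : IsDominatedKernel μ (vectorKernel fun x y => S.symbol P Q Z (x * y)) g) {z ζ : ℝ}
    (hz : z ∈ Ioo (0 : ℝ) 1) (hζ : ζ ∈ Ioo (0 : ℝ) 1) (hne : z ≠ ζ) :
    kernel Z z ζ = ∫ x, inner ℝ (S.symbol P Q Z (x * z))
      (Matrix.toEuclideanCLM (n := VecIdx p q) (𝕜 := ℝ) (sigma s) (S.symbol P Q Z (x * ζ))) ∂μ := by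
  set T := Matrix.toEuclideanCLM (n := VecIdx p q) (𝕜 := ℝ) (sigma s) with hT
  set c := √(z * ζ) / (ζ - z) with hcdef
  set F : ℝ → ℝ := fun t => c * dotProduct (Z (t * z)) (J.mulVec (Z (t * ζ))) with hF
  have hmem : ∀ {t w : ℝ}, t ∈ Ioc (0 : ℝ) 1 → w ∈ Ioo (0 : ℝ) 1 → t * w ∈ Ioo (0 : ℝ) 1 :=
    fun ht hw => ⟨mul_pos ht.1 hw.1, mul_lt_one_of_nonneg_of_lt_one_right ht.2 hw.1.le hw.2⟩
  have hmem' : ∀ {t w : ℝ}, t ∈ Ioc (0 : ℝ) 1 → w ∈ Ioo (0 : ℝ) 1 → t * w ∈ Ioo 0 d :=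
    fun ht hw => Ioo_subset_Ioo_right hd.le (hmem ht hw)
  have hderiv : ∀ t ∈ Ioo (0 : ℝ) 1, HasDerivAt F
      (t⁻¹ * inner ℝ (S.symbol P Q Z (t * z)) (T (S.symbol P Q Z (t * ζ)))) t := fun t ht => by
    have ht' := Ioo_subset_Ioc_self ht
    refine ((hZ.hasDerivAt_pairing ht.1.ne' (hmem' ht' hz) (hmem' ht' hζ)).const_mul c).congr_deriv ?_
    have hs := h.sub_mul_dotProduct_symbolVec ha hc (hmem' ht' hz) (hmem' ht' hζ) (Z (t * z))
      (Z (t * ζ))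
    have hi : inner ℝ (S.symbol P Q Z (t * z)) (T (S.symbol P Q Z (t * ζ))) =
        dotProduct (S.symbolVec P Q (t * z) (Z (t * z))).ofLp
          ((sigma s).mulVec (S.symbolVec P Q (t * ζ) (Z (t * ζ))).ofLp) := by
      rw [S.symbol_of_mem P Q Z (hmem ht' hz), S.symbol_of_mem P Q Z (hmem ht' hζ),
        EuclideanSpace.inner_eq_star_dotProduct, dotProduct_comm]
      simp [hT, Matrix.ofLp_toEuclideanCLM]
    rw [hi]
    set I := dotProduct (S.symbolVec P Q (t * z) (Z (t * z))).ofLp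
          ((sigma s).mulVec (S.symbolVec P Q (t * ζ) (Z (t * ζ))).ofLp)
    set D := dotProduct (Z (t * z)) (J.mulVec
      (((t * ζ) • S.B (t * ζ) - (t * z) • S.B (t * z)).mulVec (Z (t * ζ))))
    -- The square roots in the symbol supply a factor `t` that cancels the one in `tζ - tz`.
    have hsq : √(t * z) * √(t * ζ) = t * √(z * ζ) := by
      rw [Real.sqrt_mul ht.1.le, Real.sqrt_mul ht.1.le, Real.sqrt_mul hz.1.le, mul_mul_mul_comm,
        Real.mul_self_sqrt ht.1.le]
    have hsub : ζ - z ≠ 0 := sub_ne_zero.2 hne.symm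
    rw [hsq] at hs
    have hs' : (ζ - z) * I = √(z * ζ) * D := by
      refine mul_left_cancel₀ ht.1.ne' ?_
      linear_combination hs
    rw [hcdef, mul_left_comm]
    congr 1
    field_simp
    linear_combination -hs'
  have hint : Integrable (fun x => inner ℝ (S.symbol P Q Z (x * z)) (T (S.symbol P Q Z (x * ζ)))) μ := by
    have h1 := hk.memLp_column z
    have h2 := T.comp_memLp' (hk.memLp_column ζ)
    exact (h1.norm.integrable_mul h2.norm).mono' (h1.1.inner h2.1)
      (ae_of_all _ fun x => norm_inner_le_norm _ _)
  have hlim0 : Tendsto F (𝓝[>] 0) (𝓝 0) := by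
    have hw : ∀ w ∈ Ioo (0 : ℝ) 1, Tendsto (fun t => Z (t * w)) (𝓝[>] 0) (𝓝 0) := fun w hw => by
      refine hZ.2.comp (tendsto_nhdsWithin_iff.2 ⟨?_, ?_⟩)
      · exact (Continuous.tendsto' (f := fun t : ℝ => t * w) (by fun_prop) 0 0
          (zero_mul w)).mono_left nhdsWithin_le_nhds
      · filter_upwards [self_mem_nhdsWithin] with t ht
        exact mul_pos ht hw.1
    have hcont : Continuous fun v : (Fin 2 → ℝ) × (Fin 2 → ℝ) =>
        c * dotProduct v.1 (J.mulVec v.2) := by fun_prop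
    have h0 : c * dotProduct (0 : Fin 2 → ℝ) (J.mulVec 0) = 0 := by rw [zero_dotProduct, mul_zero]
    have h1 := (hcont.tendsto (0, 0)).comp ((hw z hz).prodMk_nhds (hw ζ hζ))
    rwa [h0] at h1
  have hlim1 : Tendsto F (𝓝[<] 1) (𝓝 (F 1)) := by
    have h1 : (1 : ℝ) ∈ Ioc (0 : ℝ) 1 := by simp
    exact ((hZ.hasDerivAt_pairing one_ne_zero (hmem' h1 hz) (hmem' h1 hζ)).const_mul
      c).continuousAt.tendsto.mono_left nhdsWithin_le_nhds
  rw [integral_μ, intervalIntegral.integral_eq_sub_of_hasDerivAt_of_tendsto zero_lt_one hderiv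
    ((intervalIntegrable_iff_integrableOn_Ioo_of_le zero_le_one).2 (integrable_μ_iff.1 hint))
    hlim0 hlim1, sub_zero]
  simp only [hF, hcdef, kernel, one_mul]
  have h1 : ζ - z ≠ 0 := sub_ne_zero.2 hne.symm
  have h2 : z - ζ ≠ 0 := sub_ne_zero.2 hne
  simp only [J, dotProduct, Matrix.mulVec, Fin.sum_univ_two, Matrix.of_apply, Matrix.cons_val_zero,
    Matrix.cons_val_one]
  rw [div_mul_eq_mul_div, div_eq_div_iff h2 h1]
  simp
  ring

end SchlesingerKernel

end

theorem theorem8p3 {p q : ℕ} (S : SchlesingerKernel.Residues p q) (d κ : ℝ)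
    (hd : 1 < d)
    (ha : ∀ k, S.a k < 0 ∨ d ≤ S.a k)
    (hc : ∀ l, (S.c l).im ≠ 0)
    (hκ_pos : Module.End.HasEigenvalue (Matrix.toLin' S.β₁) κ)
    (hκ_neg : Module.End.HasEigenvalue (Matrix.toLin' S.β₁) (-κ))
    (hκ : ∀ m : ℤ, 2 * κ ≠ m) :
    -- (i)
    (∃ Z : ℝ → Fin 2 → ℝ, S.IsVanishingSolution d Z ∧ ∃ x ∈ Set.Ioo 0 d, Z x ≠ 0) ∧
    -- the signature blocks exist
    (∃ s, S.IsSignature s) ∧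
    ∀ Z : ℝ → Fin 2 → ℝ, S.IsVanishingSolution d Z →
      ∃ K : SchlesingerKernel.Scalar →L[ℝ] SchlesingerKernel.Scalar,
        SchlesingerKernel.IsIntegralOperator K (SchlesingerKernel.kernel Z) ∧
        -- (ii)
        SchlesingerKernel.IsTraceClass K ∧
        ∀ s, S.IsSignature s →
          (∃ (ψ : ℝ → EuclideanSpace ℝ (SchlesingerKernel.VecIdx p q))
            (Γ : SchlesingerKernel.Scalar →L[ℝ] SchlesingerKernel.Vector p q),
            ContinuousOn ψ (Set.Ioo 0 1) ∧ SchlesingerKernel.IsHankelOperator Γ ψ ∧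
            K = ContinuousLinearMap.adjoint Γ ∘L
              SchlesingerKernel.matrixOp (SchlesingerKernel.sigma s) ∘L Γ) ∧
          -- (iii)
          ((SchlesingerKernel.sigma s).PosSemidef → K.IsPositive) := by
  have hκ0 : κ ≠ 0 := fun h => hκ 0 (by simp [h])
  have hev : Module.End.HasEigenvalue (Matrix.toLin' S.β₁) |κ| := by
    rcases abs_choice κ with h | h <;> rw [h] <;> assumption
  have hpos : 0 < |κ| := abs_pos.2 hκ0
  obtain ⟨Z₀, hZ₀, hZ₀', -⟩ :=
    SchlesingerKernel.Residues.exists_isVanishingSolution hd hpos ha hc hev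
  refine ⟨⟨Z₀, hZ₀, hZ₀'⟩, S.exists_isSignature, fun Z hZ => ?_⟩
  -- `K` must not depend on the signature, so it is built from one fixed choice. For any other
  -- choice, `Γ† σ Γ` has the same kernel off the diagonal and so is the same operator.
  obtain ⟨s₀, hs₀⟩ := S.exists_isSignature
  obtain ⟨P₀, Q₀, h₀⟩ := hs₀.exists_isCongruence
  obtain ⟨g₀, hk₀⟩ := hZ.exists_isDominatedKernel hd hpos ha hc hev P₀ Q₀
  have hK₀ := SchlesingerKernel.isIntegralOperator_adjoint_comp hk₀ (SchlesingerKernel.sigma s₀)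
    fun z hz ζ hζ hne => hZ.kernel_eq hd ha hc h₀ hk₀ hz hζ hne
  refine ⟨_, hK₀, SchlesingerKernel.isTraceClass_adjoint_operator_comp hk₀ _, fun s hs => ?_⟩
  obtain ⟨P, Q, h⟩ := hs.exists_isCongruence
  obtain ⟨g, hk⟩ := hZ.exists_isDominatedKernel hd hpos ha hc hev P Q
  have hK := SchlesingerKernel.isIntegralOperator_adjoint_comp hk (SchlesingerKernel.sigma s)
    fun z hz ζ hζ hne => hZ.kernel_eq hd ha hc h hk hz hζ hne
  rw [hK₀.unique hK]
  refine ⟨⟨S.symbol P Q Z, hk.operator, hZ.continuousOn_symbol hd ha hc P Q, fun f => ?_, rfl⟩,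
    fun hσ => (SchlesingerKernel.matrixOp_isPositive hσ).adjoint_conj _⟩
  filter_upwards [hk.coeFn_operator f] with x hx
  exact ⟨hk.integrable f x, hx⟩
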